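/- Let $\alpha,\beta>0$ and $\lambda_1,\lambda_2,\mu\in\mathbb R$. Let $(I(t))_{t\ge 0}$ be a continuous-time Markov chain on the states $\{1,2\}$ which jumps from state $2$ to state $1$ at rate $\beta$ and from state $1$ to state $2$ at rate $\alpha$; with the states listed in the order $(2,1)$ its generator is $Q=\begin{pmatrix}-\beta&\beta\\ \alpha&-\alpha\end{pmatrix}$. While $I(t)=i$, a fluid buffer fills at the net rate $r_i=\lambda_i-\mu$, so that (in the same order of states) $R=\mathrm{diag}(\lambda_2-\mu,\lambda_1-\mu)$ and, until it empties, the buffer content is $X(t)=x+\int_0^t r_{I(u)}\,du$ with $x>0$. Let $\tau=\inf\{t>0: X(t)=0\}$ be the starvation time, $H_{ij}(x,t)=P\{\tau\le t,\ I(\tau)=j\mid X(0)=x,\ I(0)=i\}$, and let $\tilde H_{ij}(x,\omega)=\int_0^\infty e^{-\omega t}\,dH_{ij}(x,t)$ be its Laplace–Stieltjes transform, for $\omega\in\mathbb C$ with $\mathrm{Re}\,\omega>0$. Put $b=(\lambda_1-\mu)(\omega+\beta)+(\lambda_2-\mu)(\omega+\alpha)$ and let $$s_{1},s_{2}=\frac{b\pm\sqrt{b^2-4\omega(\omega+\alpha+\beta)(\lambda_1-\mu)(\lambda_2-\mu)}}{2(\lambda_1-\mu)(\lambda_2-\mu)}$$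 ($s_1$ with the sign $+$, $s_2$ with the sign $-$, principal square root) be the roots of $\det(Q+sR-\omega I)$ in $s$; if exactly one of $\lambda_1,\lambda_2$ equals $\mu$, put $s_1=s_2=\omega(\omega+\alpha+\beta)/b$, the only root. 1. If $\lambda_1<\mu\le\lambda_2$, then $s_1$ is the only root with negative real part, $\tilde H_{12}=\tilde H_{22}=0$, and $$\begin{bmatrix}\tilde H_{21}(x,\omega)\\ \tilde H_{11}(x,\omega)\end{bmatrix}=e^{s_1x}\begin{bmatrix}\dfrac{\beta}{\beta+\omega-(\lambda_2-\mu)s_1}\\ 1\end{bmatrix}.$$ 2. If $\lambda_2<\mu\le\lambda_1$, then $s_1$ is the only root with negative real part, $\tilde H_{11}=\tilde H_{21}=0$, and $$\begin{bmatrix}\tilde H_{22}(x,\omega)\\ \tilde H_{12}(x,\omega)\end{bmatrix}=e^{s_1x}\begin{bmatrix}1\\ \dfrac{\beta+\omega-(\lambda_2-\mu)s_1}{\beta}\end{bmatrix}.$$ 3. If $\lambda_1<\mu$ and $\lambda_2<\mu$, then both roots have negative real part, they are distinct whenever $\omega$ is real, and whenever $s_1\ne s_2$, $$\begin{bmatrix}\tilde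 H_{2j}(x,\omega)\\ \tilde H_{1j}(x,\omega)\end{bmatrix}=\sum_{k=1}^{2}a_{kj}\,e^{s_kx}\begin{bmatrix}1\\ \dfrac{\beta+\omega-(\lambda_2-\mu)s_k}{\beta}\end{bmatrix}\qquad(j=1,2),$$ where $$a_{11}=\frac{\beta}{(\lambda_2-\mu)(s_2-s_1)},\quad a_{21}=\frac{\beta}{(\lambda_2-\mu)(s_1-s_2)},$$ $$a_{12}=\frac{\beta+\omega-(\lambda_2-\mu)s_2}{(\lambda_2-\mu)(s_1-s_2)},\quad a_{22}=\frac{\beta+\omega-(\lambda_2-\mu)s_1}{(\lambda_2-\mu)(s_2-s_1)}.$$ -/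

import Mathlib

open MeasureTheory

noncomputable section

namespace MMFM

/-- One-step transition probabilities of the jump chain of a conservative generator `Q`
(for states `k` that are not absorbing, `Q k k ≠ 0`). -/
def jumpProb {S : Type*} [DecidableEq S] (Q : Matrix S S ℝ) (k l : S) : ℝ :=
  if l = k then 0 else Q k l / (-Q k k)

/-- Under `P`, the process `(I t)`, `t ≥ 0`, is a continuous-time Markov chain with infinitesimal
generator `Q` (finite state space, no absorbing state) and initial state `i`, described by its
jump chain `Y` and its holding times `T`: `Y` is a discrete-time Markov chain started at `i` with
transition matrix `jumpProb Q`; given `Y`, the holding times are independent and `T k` is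
exponential with parameter `-Q (Y k) (Y k)`; and `I t = Y n` for
`T 0 + ⋯ + T (n-1) ≤ t < T 0 + ⋯ + T n`. The values `I t` for `t < 0` play no role. -/
def IsCTMC {Ω S : Type*} [MeasurableSpace Ω] [DecidableEq S]
    (P : Measure Ω) (Q : Matrix S S ℝ) (i : S) (I : ℝ → Ω → S) : Prop :=
  ∃ (Y : ℕ → Ω → S) (T : ℕ → Ω → ℝ),
    (∀ n y, MeasurableSet {w | Y n w = y}) ∧
    (∀ n, Measurable (T n)) ∧
    (∀ (n : ℕ) (y : ℕ → S) (t : ℕ → ℝ), (∀ k, 0 ≤ t k) →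
      P.real {w | ∀ k ≤ n, Y k w = y k ∧ t k < T k w} =
        (if y 0 = i then 1 else 0) *
          (∏ k ∈ Finset.range n, jumpProb Q (y k) (y (k + 1))) *
          ∏ k ∈ Finset.range (n + 1), Real.exp (Q (y k) (y k) * t k)) ∧
    (∀ᵐ w ∂P, ∀ (n : ℕ) (t : ℝ),
      ∑ k ∈ Finset.range n, T k w ≤ t → t < ∑ k ∈ Finset.range (n + 1), T k w → I t w = Y n w)

/-- The buffer content at time `t` (up to the first time it is empty) when the content at time `0`
is `x` and the net input rate is `r k` while the environment is in state `k`. -/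
def bufferContent {Ω S : Type*} (r : S → ℝ) (x : ℝ) (I : ℝ → Ω → S) (t : ℝ) (w : Ω) : ℝ :=
  x + ∫ u in (0 : ℝ)..t, r (I u w)

/-- The starvation time `τ = inf {t > 0 : X t = 0}`, equal to `⊤` if the buffer never empties. -/
def starvationTime {Ω S : Type*} (r : S → ℝ) (x : ℝ) (I : ℝ → Ω → S) (w : Ω) : EReal :=
  sInf ((fun t : ℝ => (t : EReal)) '' {t : ℝ | 0 < t ∧ bufferContent r x I t w = 0})

/-- `H (x, t) = P (τ ≤ t, I τ = j)`, as a function of `t`. -/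
def starvationProb {Ω S : Type*} [MeasurableSpace Ω] (P : Measure Ω)
    (r : S → ℝ) (I : ℝ → Ω → S) (j : S) (x t : ℝ) : ℝ :=
  P.real {w | starvationTime r x I w ≤ (t : EReal) ∧ I (starvationTime r x I w).toReal w = j}

theorem monotone_starvationProb {Ω S : Type*} [MeasurableSpace Ω] (P : Measure Ω)
    [IsFiniteMeasure P] (r : S → ℝ) (I : ℝ → Ω → S) (j : S) (x : ℝ) :
    Monotone (starvationProb P r I j x) := by
  intro s t hst
  refine measureReal_mono ?_
  rintro w ⟨h1, h2⟩
  exact ⟨h1.trans (EReal.coe_le_coe_iff.2 hst), h2⟩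

/-- The Laplace–Stieltjes transform `∫_[0,∞) exp (-ω t) dH (x, t)`. -/
def starvationLST {Ω S : Type*} [MeasurableSpace Ω] (P : Measure Ω) [IsFiniteMeasure P]
    (r : S → ℝ) (I : ℝ → Ω → S) (j : S) (x : ℝ) (ω : ℂ) : ℂ :=
  ∫ t in Set.Ici (0 : ℝ), Complex.exp (-ω * t)
    ∂(monotone_starvationProb P r I j x).stieltjesFunction.measure

/-! ### The two-state source

State `i` has arrival rate `l_i`. The rows and columns of `Q` and `R` list state `2` first and
state `1` second. -/

/-- State `1` (arrival rate `l₁`), the second row of `Q` and `R`. -/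
abbrev state1 : Fin 2 := 1

/-- State `2` (arrival rate `l₂`), the first row of `Q` and `R`. -/
abbrev state2 : Fin 2 := 0

/-- The generator. -/
def gen (α β : ℝ) : Matrix (Fin 2) (Fin 2) ℝ := !![-β, β; α, -α]

/-- The effective input rates, in the order of the rows of `gen`. -/
def rate (l₁ l₂ μ : ℝ) : Fin 2 → ℝ := ![l₂ - μ, l₁ - μ]

/-- `Δ (s, ω) = det (Q + s R - ω I)` with `R = diag (l₂ - μ, l₁ - μ)`. -/
def charDet (α β l₁ l₂ μ : ℝ) (s ω : ℂ) : ℂ :=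
  ((gen α β).map Complex.ofReal +
    s • (Matrix.diagonal (rate l₁ l₂ μ)).map Complex.ofReal - ω • 1).det

/-- Minus the coefficient of `s` in `Δ (s, ω)`. -/
def bCoef (α β l₁ l₂ μ : ℝ) (ω : ℂ) : ℂ := (l₁ - μ) * (ω + β) + (l₂ - μ) * (ω + α)

/-- The discriminant of `Δ (s, ω)` as a polynomial in `s`. -/
def discr (α β l₁ l₂ μ : ℝ) (ω : ℂ) : ℂ :=
  bCoef α β l₁ l₂ μ ω ^ 2 - 4 * ω * (ω + α + β) * (l₁ - μ) * (l₂ - μ)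

/-- The root `s₁ (ω)` (principal square root); if one of the two effective rates is zero, `Δ` is
linear in `s` and `s₁ (ω) = s₂ (ω)` is its only root. -/
def root1 (α β l₁ l₂ μ : ℝ) (ω : ℂ) : ℂ :=
  if (l₁ - μ) * (l₂ - μ) = 0 then ω * (ω + α + β) / bCoef α β l₁ l₂ μ ω
  else (bCoef α β l₁ l₂ μ ω + Complex.sqrt (discr α β l₁ l₂ μ ω)) / (2 * (l₁ - μ) * (l₂ - μ))

/-- The root `s₂ (ω)`. -/
def root2 (α β l₁ l₂ μ : ℝ) (ω : ℂ) : ℂ :=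
  if (l₁ - μ) * (l₂ - μ) = 0 then ω * (ω + α + β) / bCoef α β l₁ l₂ μ ω
  else (bCoef α β l₁ l₂ μ ω - Complex.sqrt (discr α β l₁ l₂ μ ω)) / (2 * (l₁ - μ) * (l₂ - μ))

end MMFM

end

/-!
# Starvation times of a two-state Markov modulated fluid buffer

Fix a root `s` of `det (Q + s R - ω)` with `Re s < 0`, and an eigenvector `h` with
`(Q + s R) h = ω h`. As long as the buffer is not empty, `exp (-ω t + s X t) h (I t)` is a
martingale; it is bounded since `X ≥ 0`, and it tends to `0` on the event that the buffer never
empties. Stopping it at the starvation time `τ` gives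
`E_i [exp (-ω τ) h (I τ); τ < ∞] = exp (s x) h i`, that is, one linear relation between the two
transforms for each such root (`MMFM.starvationLST_relation`). If only one state empties the buffer,
the transform of the other one vanishes (`MMFM.starvationLST_eq_zero_of_rate_nonneg`) and a single
root suffices; if both do, the two roots give a `2 × 2` linear system.

The martingale is only used at the jump epochs. The two-state chain alternates between its states,
with independent exponential holding times (`MMFM.IsCTMC.exists_holding`), and the martingale
property is first-step analysis over one holding time (`MMFM.integral_first_step`), integrated over
the past (`MMFM.integral_discount_add`). Pathwise, `τ` and `I τ` are read off the holding time
during which the buffer empties (`MMFM.starvation_iff`); this needs that almost surely the epochs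
tend to infinity and the buffer does not empty exactly at an epoch. The law of `τ` on `{I τ = j}`
is thus a sum over the holding times, and the Laplace–Stieltjes transform is the corresponding
series (`MMFM.hasSum_starvationLST`).

The number of roots in the left half-plane comes from writing the characteristic equation as
`(β + ω - r₂ s) (α + ω - r₁ s) = α β` with `rᵢ = lᵢ - μ`: wherever both factors have real part above
`β` and `α` there is no root, and if `r₁` and `r₂` have opposite signs, comparing the sum and the
product of the first factor at the two roots shows that they lie in opposite half-planes
(`MMFM.re_neg_pos_of_roots`).
-/

noncomputable section

open ProbabilityTheory

namespace MMFM

/-! ### Roots of the characteristic equation -/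

lemma lt_norm_sub_of_re {a r : ℝ} {A s : ℂ} (hA : a < A.re) (h : r * s.re ≤ 0) :
    a < ‖A - r * s‖ := by
  refine lt_of_lt_of_le ?_ (Complex.re_le_norm _)
  simp
  linarith

/-- If `ρ Re s ≤ 0` and `r Re s ≤ 0`, then `s` does not solve `(A - ρ s) (B - r s) = a b`, because
the two factors have moduli above `a` and `b`. -/
lemma mul_ne_of_re {a b ρ r : ℝ} {A B s : ℂ} (ha : 0 < a) (hb : 0 < b) (hA : a < A.re)
    (hB : b < B.re) (hρ : ρ * s.re ≤ 0) (hr : r * s.re ≤ 0) :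
    (A - ρ * s) * (B - r * s) ≠ a * b := by
  intro h
  have h1 := lt_norm_sub_of_re hA hρ
  have h2 := lt_norm_sub_of_re hB hr
  have h3 : ‖A - ρ * s‖ * ‖B - r * s‖ = a * b := by
    rw [← norm_mul, h]; simp [abs_of_pos ha, abs_of_pos hb]
  nlinarith [mul_lt_mul'' h1 h2 ha.le hb.le]

/-- Two complex numbers whose product has modulus `c d`, and which both lie outside the disc of
radius `c`, have a sum of modulus, hence of real part, less than `c + d`. -/
lemma re_add_lt_of_norm_mul {c d : ℝ} {u v : ℂ} (hc : 0 < c) (hu : c < ‖u‖) (hv : c < ‖v‖)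
    (huv : ‖u‖ * ‖v‖ = c * d) : (u + v).re < c + d := by
  refine (Complex.re_le_norm _).trans_lt ((norm_add_le _ _).trans_lt ?_)
  have := mul_pos (sub_pos.2 hu) (sub_pos.2 hv)
  nlinarith

/-- Of the two roots of `(A - ρ s) (B - r s) = a b` with `r < 0 < ρ`, exactly one lies in the left
half-plane. The numbers `A - ρ sₖ` have sum `A + c B` and product `a b c` with `c = -ρ / r`;
if the `sₖ` lay in the same half-plane, both would lie outside the disc of radius `a`, or of
radius `c b`, and their sum would have real part less than `a + c b`. -/
lemma re_neg_pos_of_roots {a b ρ r : ℝ} {A B s₁ s₂ : ℂ} (ha : 0 < a) (hb : 0 < b) (hA : a < A.re)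
    (hB : b < B.re) (hr : r < 0) (hρ : 0 < ρ)
    (hsum : ρ * r * (s₁ + s₂) = A * r + B * ρ) (hprod : ρ * r * (s₁ * s₂) = A * B - a * b)
    (hle : s₁.re ≤ s₂.re) : s₁.re < 0 ∧ 0 < s₂.re := by
  obtain ⟨c, hc⟩ : ∃ c, c = ρ / (-r) := ⟨_, rfl⟩
  have hc0 : 0 < c := hc ▸ div_pos hρ (neg_pos.2 hr)
  have hcr : -(c * r) = ρ := by rw [hc]; field_simp [hr.ne]
  have hcr' : -((c : ℂ) * r) = ρ := by exact_mod_cast hcr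
  have hrC : (r : ℂ) ≠ 0 := by exact_mod_cast hr.ne
  -- the sum of the numbers `A - ρ sₖ`, and each of them in terms of the other root
  have hs : c * r * (s₁ + s₂) = c * B - A := by
    refine mul_left_cancel₀ hrC ?_
    rw [← hcr'] at hsum
    linear_combination -hsum
  have e1 : A - ρ * s₁ = c * (B - r * s₂) := by rw [← hcr']; linear_combination hs
  have e2 : A - ρ * s₂ = c * (B - r * s₁) := by rw [← hcr']; linear_combination hs
  have hadd : ((A - ρ * s₁) + (A - ρ * s₂)).re = A.re + c * B.re := by
    have : (A - ρ * s₁) + (A - ρ * s₂) = A + c * B := by rw [← hcr']; linear_combination hs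
    rw [this]; simp
  have p1 : (A - ρ * s₁) * (B - r * s₁) = a * b := by linear_combination s₁ * hsum - hprod
  have p2 : (A - ρ * s₂) * (B - r * s₂) = a * b := by linear_combination s₂ * hsum - hprod
  have hnorm : ‖A - ρ * s₁‖ * ‖A - ρ * s₂‖ = a * (c * b) := by
    rw [← norm_mul, e2, mul_left_comm, p1]
    simp [abs_of_pos ha, abs_of_pos hb, abs_of_pos hc0]; ring
  have hcB : c * b < c * B.re := mul_lt_mul_of_pos_left hB hc0
  have n1 : s₁.re ≠ 0 := fun h => mul_ne_of_re ha hb hA hB (by simp [h]) (by simp [h]) p1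
  have n2 : s₂.re ≠ 0 := fun h => mul_ne_of_re ha hb hA hB (by simp [h]) (by simp [h]) p2
  constructor
  · by_contra hneg
    have h1 : 0 < s₁.re := lt_of_le_of_ne (not_lt.1 hneg) n1.symm
    have h2 : 0 < s₂.re := h1.trans_le hle
    have k1 := lt_norm_sub_of_re hB (mul_nonpos_of_nonpos_of_nonneg hr.le h2.le)
    have k2 := lt_norm_sub_of_re hB (mul_nonpos_of_nonpos_of_nonneg hr.le h1.le)
    have := re_add_lt_of_norm_mul (c := c * b) (d := a) (u := A - ρ * s₁) (v := A - ρ * s₂)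
      (by positivity)
      (by rw [e1, norm_mul, Complex.norm_of_nonneg hc0.le]; exact mul_lt_mul_of_pos_left k1 hc0)
      (by rw [e2, norm_mul, Complex.norm_of_nonneg hc0.le]; exact mul_lt_mul_of_pos_left k2 hc0)
      (by rw [hnorm]; ring)
    linarith
  · by_contra hpos
    have h2 : s₂.re < 0 := lt_of_le_of_ne (not_lt.1 hpos) n2
    have h1 : s₁.re < 0 := hle.trans_lt h2
    have := re_add_lt_of_norm_mul ha
      (lt_norm_sub_of_re hA (mul_nonpos_of_nonneg_of_nonpos hρ.le h1.le))
      (lt_norm_sub_of_re hA (mul_nonpos_of_nonneg_of_nonpos hρ.le h2.le)) hnorm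
    linarith

section Roots

variable {α β l₁ l₂ μ : ℝ} {ω s : ℂ}

lemma charDet_eq (α β l₁ l₂ μ : ℝ) (s ω : ℂ) :
    charDet α β l₁ l₂ μ s ω =
      (β + ω - (l₂ - μ) * s) * (α + ω - (l₁ - μ) * s) - β * α := by
  simp [charDet, gen, rate, Matrix.det_fin_two]
  ring

lemma charDet_eq_zero_iff :
    charDet α β l₁ l₂ μ s ω = 0 ↔
      (β + ω - (l₂ - μ) * s) * (α + ω - (l₁ - μ) * s) = β * α := by
  rw [charDet_eq, sub_eq_zero]

lemma charDet_ne_zero (hα : 0 < α) (hβ : 0 < β) (hω : 0 < ω.re)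
    (h₂ : (l₂ - μ) * s.re ≤ 0) (h₁ : (l₁ - μ) * s.re ≤ 0) :
    charDet α β l₁ l₂ μ s ω ≠ 0 := by
  rw [Ne, charDet_eq_zero_iff]
  have := mul_ne_of_re (A := β + ω) (B := α + ω) hβ hα (by simpa) (by simpa) h₂ h₁
  simpa using this

lemma sqrt_sq (z : ℂ) : Complex.sqrt z ^ 2 = z := by
  simp [Complex.sqrt]

lemma sqrt_re_nonneg (z : ℂ) : 0 ≤ (Complex.sqrt z).re := by
  rw [Complex.sqrt, Complex.cpow_inv_two_re]
  positivity

lemma root1_add_root2 (h : (l₁ - μ) * (l₂ - μ) ≠ 0) :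
    ((l₂ - μ : ℝ) : ℂ) * ((l₁ - μ : ℝ) : ℂ) * (root1 α β l₁ l₂ μ ω + root2 α β l₁ l₂ μ ω) =
      (β + ω) * ((l₁ - μ : ℝ) : ℂ) + (α + ω) * ((l₂ - μ : ℝ) : ℂ) := by
  have h' : ((l₁ : ℂ) - μ) * (l₂ - μ) ≠ 0 := by exact_mod_cast h
  have h1 := left_ne_zero_of_mul h'
  have h2 := right_ne_zero_of_mul h'
  rw [root1, root2, if_neg h, if_neg h]
  push_cast
  field_simp
  rw [bCoef]
  ring

lemma root1_mul_root2 (h : (l₁ - μ) * (l₂ - μ) ≠ 0) :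
    ((l₂ - μ : ℝ) : ℂ) * ((l₁ - μ : ℝ) : ℂ) * (root1 α β l₁ l₂ μ ω * root2 α β l₁ l₂ μ ω) =
      (β + ω) * (α + ω) - β * α := by
  have h' : ((l₁ : ℂ) - μ) * (l₂ - μ) ≠ 0 := by exact_mod_cast h
  have h1 := left_ne_zero_of_mul h'
  have h2 := right_ne_zero_of_mul h'
  have hs := sqrt_sq (discr α β l₁ l₂ μ ω)
  rw [root1, root2, if_neg h, if_neg h]
  push_cast
  field_simp
  rw [← sq_sub_sq, hs, discr]
  ring

lemma charDet_eq_zero_iff_root (h : (l₁ - μ) * (l₂ - μ) ≠ 0) :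
    charDet α β l₁ l₂ μ s ω = 0 ↔ s = root1 α β l₁ l₂ μ ω ∨ s = root2 α β l₁ l₂ μ ω := by
  have hs := root1_add_root2 (α := α) (β := β) (ω := ω) h
  have hp := root1_mul_root2 (α := α) (β := β) (ω := ω) h
  have h' : ((l₁ : ℂ) - μ) * (l₂ - μ) ≠ 0 := by exact_mod_cast h
  push_cast at hs hp
  have : charDet α β l₁ l₂ μ s ω = ((l₁ - μ) * (l₂ - μ)) *
      ((s - root1 α β l₁ l₂ μ ω) * (s - root2 α β l₁ l₂ μ ω)) := by
    rw [charDet_eq]; linear_combination s * hs - hp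
  rw [this, mul_eq_zero, or_iff_right h', mul_eq_zero, sub_eq_zero, sub_eq_zero]

lemma root1_re_le_root2_re (h : (l₁ - μ) * (l₂ - μ) < 0) :
    (root1 α β l₁ l₂ μ ω).re ≤ (root2 α β l₁ l₂ μ ω).re := by
  have h' : ((l₁ : ℂ) - μ) * (l₂ - μ) ≠ 0 := by exact_mod_cast h.ne
  have h1 := left_ne_zero_of_mul h'
  have h2 := right_ne_zero_of_mul h'
  have key : (((l₁ - μ) * (l₂ - μ) : ℝ) : ℂ) * (root1 α β l₁ l₂ μ ω - root2 α β l₁ l₂ μ ω) =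
      Complex.sqrt (discr α β l₁ l₂ μ ω) := by
    rw [root1, root2, if_neg h.ne, if_neg h.ne]
    push_cast
    field_simp
    ring
  have hre := sqrt_re_nonneg (discr α β l₁ l₂ μ ω)
  rw [← key, Complex.re_ofReal_mul, Complex.sub_re] at hre
  nlinarith

lemma root1_swap : root1 α β l₁ l₂ μ ω = root1 β α l₂ l₁ μ ω := by
  have hb : bCoef α β l₁ l₂ μ ω = bCoef β α l₂ l₁ μ ω := by simp only [bCoef]; ring
  have hd : discr α β l₁ l₂ μ ω = discr β α l₂ l₁ μ ω := by simp only [discr, hb]; ring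
  simp only [root1, hb, hd, mul_comm (l₁ - μ) (l₂ - μ), mul_right_comm _ ((l₁ : ℂ) - μ),
    add_right_comm ω (α : ℂ)]

lemma charDet_swap : charDet α β l₁ l₂ μ s ω = charDet β α l₂ l₁ μ s ω := by
  rw [charDet_eq, charDet_eq]; ring

/-- If only state `1` empties the buffer, `s₁` is the only root in the left half-plane. -/
lemma charDet_eq_zero_and_re_neg_iff (hα : 0 < α) (hβ : 0 < β) (hω : 0 < ω.re)
    (h₁ : l₁ < μ) (h₂ : μ ≤ l₂) :
    charDet α β l₁ l₂ μ s ω = 0 ∧ s.re < 0 ↔ s = root1 α β l₁ l₂ μ ω := by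
  have hr : l₁ - μ < 0 := sub_neg.2 h₁
  rcases h₂.eq_or_lt with rfl | h₂
  · -- the characteristic equation is linear, and its root cannot lie in the right half-plane
    have hA : (β : ℂ) + ω ≠ 0 := by
      intro h
      have : β + ω.re = 0 := by simpa using congrArg Complex.re h
      linarith
    have hrC : (l₁ : ℂ) - μ ≠ 0 := by exact_mod_cast hr.ne
    have hiff : charDet α β l₁ μ μ s ω = 0 ↔ s = root1 α β l₁ μ μ ω := by
      have hA' : ω + (β : ℂ) ≠ 0 := by rwa [add_comm]
      rw [charDet_eq, root1, if_pos (by simp), bCoef, sub_self, zero_mul, zero_mul, add_zero,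
        eq_div_iff (mul_ne_zero hrC hA')]
      constructor <;> intro h <;> linear_combination -h
    refine ⟨fun h => hiff.1 h.1, fun h => ⟨hiff.2 h, ?_⟩⟩
    by_contra hre
    exact charDet_ne_zero hα hβ hω (by simp)
      (mul_nonpos_of_nonpos_of_nonneg hr.le (not_lt.1 hre)) (hiff.2 h)
  · have hρ : 0 < l₂ - μ := sub_pos.2 h₂
    have hne : (l₁ - μ) * (l₂ - μ) < 0 := mul_neg_of_neg_of_pos hr hρ
    obtain ⟨k1, k2⟩ := re_neg_pos_of_roots (A := β + ω) (B := α + ω) hβ hα (by simpa) (by simpa) hr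
      hρ (root1_add_root2 hne.ne) (root1_mul_root2 hne.ne) (root1_re_le_root2_re hne)
    rw [charDet_eq_zero_iff_root hne.ne]
    constructor
    · rintro ⟨rfl | rfl, h⟩
      · rfl
      · exact absurd h k2.not_gt
    · rintro rfl
      exact ⟨Or.inl rfl, k1⟩

/-- If both states empty the buffer, all roots lie in the left half-plane. -/
lemma re_neg_of_charDet_eq_zero (hα : 0 < α) (hβ : 0 < β) (hω : 0 < ω.re)
    (h₁ : l₁ < μ) (h₂ : l₂ < μ) (h : charDet α β l₁ l₂ μ s ω = 0) : s.re < 0 := by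
  by_contra hre
  exact charDet_ne_zero hα hβ hω
    (mul_nonpos_of_nonpos_of_nonneg (sub_neg.2 h₂).le (not_lt.1 hre))
    (mul_nonpos_of_nonpos_of_nonneg (sub_neg.2 h₁).le (not_lt.1 hre)) h

/-- For real `ω` the discriminant is `((l₁-μ)(ω+β) - (l₂-μ)(ω+α))² + 4αβ(l₁-μ)(l₂-μ) > 0`. -/
lemma root1_ne_root2 (hα : 0 < α) (hβ : 0 < β) (h : 0 < (l₁ - μ) * (l₂ - μ)) (hω : ω.im = 0) :
    root1 α β l₁ l₂ μ ω ≠ root2 α β l₁ l₂ μ ω := by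
  have h' : ((l₁ : ℂ) - μ) * (l₂ - μ) ≠ 0 := by exact_mod_cast h.ne'
  have h1 := left_ne_zero_of_mul h'
  have h2 := right_ne_zero_of_mul h'
  obtain ⟨w, rfl⟩ : ∃ w : ℝ, ω = w := ⟨ω.re, by apply Complex.ext <;> simp [hω]⟩
  intro heq
  have hs : Complex.sqrt (discr α β l₁ l₂ μ w) = 0 := by
    rw [root1, root2, if_neg h.ne', if_neg h.ne'] at heq
    field_simp at heq
    linear_combination (1 / 2 : ℂ) * heq
  have hd : discr α β l₁ l₂ μ w = 0 := by rw [← sqrt_sq (discr α β l₁ l₂ μ w), hs]; simp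
  have : discr α β l₁ l₂ μ w = ((((l₁ - μ) * (w + β) - (l₂ - μ) * (w + α)) ^ 2 +
      4 * (α * β * ((l₁ - μ) * (l₂ - μ))) : ℝ) : ℂ) := by
    rw [discr, bCoef]; push_cast; ring
  rw [this, Complex.ofReal_eq_zero] at hd
  have : 0 < α * β * ((l₁ - μ) * (l₂ - μ)) := by positivity
  nlinarith [sq_nonneg ((l₁ - μ) * (w + β) - (l₂ - μ) * (w + α))]

end Roots

/-! ### Paths of the buffer content -/

/-- The buffer content at the `n`-th jump of the environment, when the `k`-th holding time is `T k`
and the net input rate during it is `ρ k`, set to `0` from the first empty jump epoch on. With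
positive holding times it is positive exactly as long as the buffer has not been empty. -/
def killedContent (ρ T : ℕ → ℝ) (x : ℝ) : ℕ → ℝ
  | 0 => x
  | n + 1 => if 0 < killedContent ρ T x n then max 0 (killedContent ρ T x n + ρ n * T n) else 0

section Killed

variable {ρ T : ℕ → ℝ} {x : ℝ}

lemma killedContent_succ (ρ T : ℕ → ℝ) (x : ℝ) (n : ℕ) : killedContent ρ T x (n + 1) =
    if 0 < killedContent ρ T x n then max 0 (killedContent ρ T x n + ρ n * T n) else 0 := rfl

lemma killedContent_succ_pos {n : ℕ} (h : 0 < killedContent ρ T x (n + 1)) :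
    0 < killedContent ρ T x n ∧
      killedContent ρ T x (n + 1) = killedContent ρ T x n + ρ n * T n := by
  rw [killedContent_succ] at h ⊢
  split_ifs at h ⊢ with h0
  · refine ⟨h0, max_eq_right ?_⟩
    rcases lt_max_iff.1 h with h | h
    · exact absurd h (lt_irrefl _)
    · exact h.le
  · exact absurd h (lt_irrefl _)

lemma killedContent_pos_of_le {m n : ℕ} (hmn : m ≤ n) (h : 0 < killedContent ρ T x n) :
    0 < killedContent ρ T x m := by
  induction n, hmn using Nat.le_induction with
  | base => exact h
  | succ n _ ih => exact ih (killedContent_succ_pos h).1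

/-- The buffer empties during at most one holding time. -/
lemma starvation_step_unique {m n : ℕ} (hm : 0 < killedContent ρ T x m)
    (hm' : killedContent ρ T x m + ρ m * T m ≤ 0) (hn : 0 < killedContent ρ T x n)
    (hn' : killedContent ρ T x n + ρ n * T n ≤ 0) : m = n := by
  wlog hmn : m ≤ n generalizing m n
  · exact (this hn hn' hm hm' (not_le.1 hmn).le).symm
  refine le_antisymm hmn (not_lt.1 fun hlt => ?_)
  have h := killedContent_succ_pos (killedContent_pos_of_le (Nat.succ_le_of_lt hlt) hn)
  have h1 := killedContent_pos_of_le (Nat.succ_le_of_lt hlt) hn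
  rw [Nat.succ_eq_add_one, h.2] at h1
  linarith

end Killed

section Path

variable {Ω S : Type*} {r : S → ℝ} {x : ℝ} {I : ℝ → Ω → S} {w : Ω} {y : ℕ → S} {T : ℕ → ℝ}

lemma epoch_nonneg (hT : ∀ k, 0 < T k) (n : ℕ) : 0 ≤ ∑ k ∈ Finset.range n, T k :=
  Finset.sum_nonneg fun k _ => (hT k).le

lemma intervalIntegral_holding {n : ℕ} {t : ℝ}
    (hI : ∀ u, ∑ k ∈ Finset.range n, T k ≤ u → u < ∑ k ∈ Finset.range (n + 1), T k → I u w = y n)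
    (h0 : ∑ k ∈ Finset.range n, T k ≤ t) (h1 : t ≤ ∑ k ∈ Finset.range (n + 1), T k) :
    IntervalIntegrable (fun u => r (I u w)) volume (∑ k ∈ Finset.range n, T k) t ∧
      ∫ u in (∑ k ∈ Finset.range n, T k)..t, r (I u w) =
        r (y n) * (t - ∑ k ∈ Finset.range n, T k) := by
  have hae : ∀ᵐ u ∂(volume.restrict (Set.uIoc (∑ k ∈ Finset.range n, T k) t)),
      r (I u w) = r (y n) := by
    rw [Set.uIoc_of_le h0, ← restrict_Ioo_eq_restrict_Ioc]
    filter_upwards [ae_restrict_mem measurableSet_Ioo] with u hu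
    rw [hI u hu.1.le (hu.2.trans_le h1)]
  refine ⟨(intervalIntegrable_const (c := r (y n))).congr_ae (hae.mono fun u hu => hu.symm), ?_⟩
  rw [intervalIntegral.integral_congr_ae_restrict hae, intervalIntegral.integral_const, smul_eq_mul,
    mul_comm]

lemma intervalIntegrable_rate
    (hT : ∀ k, 0 < T k)
    (hI : ∀ n u, ∑ k ∈ Finset.range n, T k ≤ u → u < ∑ k ∈ Finset.range (n + 1), T k →
      I u w = y n) (n : ℕ) :
    IntervalIntegrable (fun u => r (I u w)) volume 0 (∑ k ∈ Finset.range n, T k) := by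
  induction n with
  | zero => simp
  | succ n ih =>
    refine ih.trans (intervalIntegral_holding (hI n) ?_ le_rfl).1
    rw [Finset.sum_range_succ]
    linarith [hT n]

lemma bufferContent_holding
    (hT : ∀ k, 0 < T k)
    (hI : ∀ n u, ∑ k ∈ Finset.range n, T k ≤ u → u < ∑ k ∈ Finset.range (n + 1), T k →
      I u w = y n) {n : ℕ} {t : ℝ}
    (h0 : ∑ k ∈ Finset.range n, T k ≤ t) (h1 : t ≤ ∑ k ∈ Finset.range (n + 1), T k) :
    bufferContent r x I t w = bufferContent r x I (∑ k ∈ Finset.range n, T k) w +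
      r (y n) * (t - ∑ k ∈ Finset.range n, T k) := by
  obtain ⟨hint, heq⟩ := intervalIntegral_holding (r := r) (hI n) h0 h1
  rw [bufferContent, ← intervalIntegral.integral_add_adjacent_intervals
    (intervalIntegrable_rate hT hI n) hint, heq, bufferContent, add_assoc]

lemma bufferContent_epoch
    (hT : ∀ k, 0 < T k)
    (hI : ∀ n u, ∑ k ∈ Finset.range n, T k ≤ u → u < ∑ k ∈ Finset.range (n + 1), T k →
      I u w = y n) {n : ℕ} (hn : 0 < killedContent (fun k => r (y k)) T x n) :
    bufferContent r x I (∑ k ∈ Finset.range n, T k) w =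
      killedContent (fun k => r (y k)) T x n := by
  induction n with
  | zero => simp [bufferContent, killedContent]
  | succ n ih =>
    obtain ⟨h, h'⟩ := killedContent_succ_pos hn
    rw [bufferContent_holding hT hI (n := n)
      (by rw [Finset.sum_range_succ]; linarith [hT n]) le_rfl, ih h, h', Finset.sum_range_succ]
    ring

lemma bufferContent_pos
    (hT : ∀ k, 0 < T k)
    (hI : ∀ n u, ∑ k ∈ Finset.range n, T k ≤ u → u < ∑ k ∈ Finset.range (n + 1), T k →
      I u w = y n) {n : ℕ} (hn : 0 < killedContent (fun k => r (y k)) T x n) {t : ℝ} (h0 : 0 ≤ t)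
    (h1 : t ≤ ∑ k ∈ Finset.range n, T k) : 0 < bufferContent r x I t w := by
  induction n with
  | zero =>
    obtain rfl : t = 0 := le_antisymm (by simpa using h1) h0
    simpa [bufferContent, killedContent] using hn
  | succ n ih =>
    obtain ⟨h, h'⟩ := killedContent_succ_pos hn
    rcases le_total t (∑ k ∈ Finset.range n, T k) with hle | hle
    · exact ih h hle
    · rw [bufferContent_holding hT hI hle h1, bufferContent_epoch hT hI h]
      rw [h'] at hn
      rw [Finset.sum_range_succ] at h1
      -- the content is affine on the holding interval and positive at both its ends
      rcases le_total 0 (r (y n)) with hr | hr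
      · have := mul_nonneg hr (sub_nonneg.2 hle)
        linarith
      · nlinarith

/-- If the buffer empties strictly inside the `n`-th holding time, this determines the starvation
time and the state of the environment at that time. -/
lemma starvationTime_eq
    (hT : ∀ k, 0 < T k)
    (hI : ∀ n u, ∑ k ∈ Finset.range n, T k ≤ u → u < ∑ k ∈ Finset.range (n + 1), T k →
      I u w = y n) {n : ℕ} (hn : 0 < killedContent (fun k => r (y k)) T x n)
    (hn' : killedContent (fun k => r (y k)) T x n + r (y n) * T n < 0) :
    starvationTime r x I w = ((∑ k ∈ Finset.range n, T k +
        killedContent (fun k => r (y k)) T x n / -r (y n) : ℝ) : EReal) ∧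
      I (∑ k ∈ Finset.range n, T k + killedContent (fun k => r (y k)) T x n / -r (y n)) w =
        y n := by
  set V := killedContent (fun k => r (y k)) T x n
  have hr : 0 < -r (y n) := by
    by_contra h
    nlinarith [hT n]
  have hc : 0 < V / -r (y n) := div_pos hn hr
  have hc' : V / -r (y n) < T n := by rw [div_lt_iff₀ hr]; linarith
  have hlt : ∑ k ∈ Finset.range n, T k + V / -r (y n) < ∑ k ∈ Finset.range (n + 1), T k := by
    rw [Finset.sum_range_succ]; linarith
  refine ⟨?_, hI n _ (by linarith) hlt⟩
  refine IsLeast.csInf_eq ⟨⟨_, ⟨?_, ?_⟩, rfl⟩, ?_⟩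
  · linarith [epoch_nonneg hT n]
  · rw [bufferContent_holding hT hI (n := n) (by linarith) hlt.le, bufferContent_epoch hT hI hn]
    have hr' : r (y n) ≠ 0 := (neg_pos.1 hr).ne
    change V + _ = 0
    field_simp
    ring
  · rintro _ ⟨t, ⟨ht0, ht⟩, rfl⟩
    refine EReal.coe_le_coe_iff.2 (not_lt.1 fun htc => ht.not_gt ?_)
    rcases le_total t (∑ k ∈ Finset.range n, T k) with hle | hle
    · exact bufferContent_pos hT hI hn ht0.le hle
    · rw [bufferContent_holding hT hI hle (htc.trans hlt).le, bufferContent_epoch hT hI hn]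
      have : (t - ∑ k ∈ Finset.range n, T k) * -r (y n) < V := by
        rw [← lt_div_iff₀ hr]; linarith
      change 0 < V + _
      linarith

lemma starvationTime_eq_top
    (hT : ∀ k, 0 < T k)
    (hI : ∀ n u, ∑ k ∈ Finset.range n, T k ≤ u → u < ∑ k ∈ Finset.range (n + 1), T k →
      I u w = y n)
    (hS : Filter.Tendsto (fun n => ∑ k ∈ Finset.range n, T k) Filter.atTop Filter.atTop)
    (hV : ∀ n, 0 < killedContent (fun k => r (y k)) T x n) : starvationTime r x I w = ⊤ := by
  rw [starvationTime, sInf_eq_top]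
  rintro _ ⟨t, ⟨ht0, ht⟩, rfl⟩
  obtain ⟨n, hn⟩ := (hS.eventually_ge_atTop t).exists
  exact absurd ht (bufferContent_pos hT hI (hV n) ht0.le hn).ne'

/-- On a path whose jump epochs tend to infinity and whose buffer is not empty at a jump epoch,
the event `τ ≤ t, I τ = j` is decided by the holding time during which the buffer empties. -/
lemma starvation_iff (hx : 0 < x)
    (hT : ∀ k, 0 < T k)
    (hI : ∀ n u, ∑ k ∈ Finset.range n, T k ≤ u → u < ∑ k ∈ Finset.range (n + 1), T k →
      I u w = y n)
    (hS : Filter.Tendsto (fun n => ∑ k ∈ Finset.range n, T k) Filter.atTop Filter.atTop)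
    (hne : ∀ n, 0 < killedContent (fun k => r (y k)) T x n →
      killedContent (fun k => r (y k)) T x n + r (y n) * T n ≠ 0) (j : S) (t : ℝ) :
    (starvationTime r x I w ≤ (t : EReal) ∧ I (starvationTime r x I w).toReal w = j) ↔
      ∃ n, y n = j ∧ (0 < killedContent (fun k => r (y k)) T x n ∧
        killedContent (fun k => r (y k)) T x n + r (y n) * T n ≤ 0) ∧
        ∑ k ∈ Finset.range n, T k + killedContent (fun k => r (y k)) T x n / -r (y n) ≤ t := by
  have key : ∀ n, 0 < killedContent (fun k => r (y k)) T x n →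
      killedContent (fun k => r (y k)) T x n + r (y n) * T n ≤ 0 → _ := fun n hn hn' =>
    starvationTime_eq hT hI hn (lt_of_le_of_ne hn' (hne n hn))
  constructor
  · rintro ⟨h1, h2⟩
    -- the first epoch with killed content `0` ends the holding time during which the buffer empties
    have hex : ∃ n, ¬ 0 < killedContent (fun k => r (y k)) T x n := by
      by_contra! hV
      rw [starvationTime_eq_top hT hI hS hV] at h1
      exact absurd h1 (by simp)
    classical
    obtain ⟨n, hn⟩ : ∃ n, Nat.find hex = n + 1 :=
      Nat.exists_eq_succ_of_ne_zero fun h0 => Nat.find_spec hex (by rw [h0]; exact hx)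
    have hpos : 0 < killedContent (fun k => r (y k)) T x n :=
      not_not.1 (Nat.find_min hex (by omega))
    have hle : killedContent (fun k => r (y k)) T x n + r (y n) * T n ≤ 0 := by
      have := Nat.find_spec hex
      rw [hn, killedContent_succ, if_pos hpos] at this
      exact (le_max_right _ _).trans (not_lt.1 this)
    obtain ⟨e1, e2⟩ := key n hpos hle
    rw [e1, EReal.toReal_coe, e2] at h2
    rw [e1, EReal.coe_le_coe_iff] at h1
    exact ⟨n, h2, ⟨hpos, hle⟩, h1⟩
  · rintro ⟨n, hj, ⟨hpos, hle⟩, ht⟩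
    obtain ⟨e1, e2⟩ := key n hpos hle
    rw [e1, EReal.toReal_coe, e2]
    exact ⟨EReal.coe_le_coe_iff.2 ht, hj⟩

end Path

/-! ### Holding times of the two-state source -/

section Exponential

variable {Ω : Type*} [MeasurableSpace Ω] {P : Measure Ω} {T : ℕ → Ω → ℝ} {q : ℕ → ℝ}

/-- The joint survival function along an arbitrary finite set of indices, and at thresholds that may
be negative, where positivity of the `T k` makes them void. -/
lemma measureReal_forall_mem_lt
    (hpos : ∀ᵐ w ∂P, ∀ k, 0 < T k w)
    (hsurv : ∀ (n : ℕ) (t : ℕ → ℝ), (∀ k, 0 ≤ t k) →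
      P.real {w | ∀ k ≤ n, t k < T k w} = ∏ k ∈ Finset.range (n + 1), Real.exp (-q k * t k))
    (s : Finset ℕ) (a : ℕ → ℝ) :
    P.real {w | ∀ k ∈ s, a k < T k w} = ∏ k ∈ s, Real.exp (-q k * max (a k) 0) := by
  have hle : ∀ k ∈ s, k ≤ s.sup id := fun k hk => Finset.le_sup (f := id) hk
  have h := hsurv (s.sup id) (fun k => if k ∈ s then max (a k) 0 else 0)
    (fun k => by split_ifs <;> simp)
  have hset : {w | ∀ k ∈ s, a k < T k w} =ᵐ[P]
      {w | ∀ k ≤ s.sup id, (if k ∈ s then max (a k) 0 else 0) < T k w} := by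
    filter_upwards [hpos] with w hw
    refine propext ⟨fun h k _ => ?_, fun h k hk => ?_⟩
    · split_ifs with hk
      · exact max_lt (h k hk) (hw k)
      · exact hw k
    · have := h k (hle k hk)
      rw [if_pos hk] at this
      exact (le_max_left _ _).trans_lt this
  rw [measureReal_congr hset, h]
  symm
  refine Finset.prod_subset_one_on_sdiff
    (fun k hk => Finset.mem_range.2 (Nat.lt_succ_of_le (hle k hk))) (fun k hk => ?_)
    (fun k hk => by rw [if_pos hk])
  rw [if_neg (Finset.mem_sdiff.1 hk).2, mul_zero, Real.exp_zero]

lemma measureReal_lt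
    (hpos : ∀ᵐ w ∂P, ∀ k, 0 < T k w)
    (hsurv : ∀ (n : ℕ) (t : ℕ → ℝ), (∀ k, 0 ≤ t k) →
      P.real {w | ∀ k ≤ n, t k < T k w} = ∏ k ∈ Finset.range (n + 1), Real.exp (-q k * t k))
    (k : ℕ) (a : ℝ) : P.real {w | a < T k w} = Real.exp (-q k * max a 0) := by
  simpa using measureReal_forall_mem_lt hpos hsurv {k} (fun _ => a)

variable [IsProbabilityMeasure P]

lemma map_eq_expMeasure (hq : ∀ k, 0 < q k) (hT : ∀ k, Measurable (T k))
    (hpos : ∀ᵐ w ∂P, ∀ k, 0 < T k w)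
    (hsurv : ∀ (n : ℕ) (t : ℕ → ℝ), (∀ k, 0 ≤ t k) →
      P.real {w | ∀ k ≤ n, t k < T k w} = ∏ k ∈ Finset.range (n + 1), Real.exp (-q k * t k))
    (k : ℕ) : P.map (T k) = expMeasure (q k) := by
  have := isProbabilityMeasure_expMeasure (hq k)
  have := Measure.isProbabilityMeasure_map (μ := P) (hT k).aemeasurable
  refine Measure.eq_of_cdf _ _ (StieltjesFunction.ext fun t => ?_)
  rw [cdf_expMeasure_eq (hq k), cdf_eq_real, map_measureReal_apply (hT k) measurableSet_Iic]
  have hc : T k ⁻¹' Set.Iic t = {w | t < T k w}ᶜ := by ext w; simp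
  rw [hc, probReal_compl_eq_one_sub (measurableSet_lt measurable_const (hT k)),
    measureReal_lt hpos hsurv]
  split_ifs with h
  · rw [max_eq_left h, neg_mul]
  · rw [max_eq_right (not_le.1 h).le]; simp

lemma iIndepFun_of_survival (hT : ∀ k, Measurable (T k))
    (hpos : ∀ᵐ w ∂P, ∀ k, 0 < T k w)
    (hsurv : ∀ (n : ℕ) (t : ℕ → ℝ), (∀ k, 0 ≤ t k) →
      P.real {w | ∀ k ≤ n, t k < T k w} = ∏ k ∈ Finset.range (n + 1), Real.exp (-q k * t k)) :
    iIndepFun T P := by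
  rw [iIndepFun_iff_iIndep]
  refine iIndepSets.iIndep (fun k => (hT k).comap_le)
    (fun k => Set.preimage (T k) '' Set.range Set.Ioi) (fun k => ?_) (fun k => ?_) ?_
  · exact isPiSystem_Ioi.comap (T k)
  · rw [BorelSpace.measurable_eq (α := ℝ), borel_eq_generateFrom_Ioi,
      MeasurableSpace.comap_generateFrom]
  · rw [iIndepSets_iff]
    intro s f hf
    choose! a ha using fun k hk => (Set.mem_image _ _ _).1 (hf k hk)
    choose! b hb using fun k hk => (ha k hk).1
    have hf' : ∀ k ∈ s, f k = {w | b k < T k w} := fun k hk => by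
      rw [← (ha k hk).2, ← hb k hk]; rfl
    have hI : (⋂ k ∈ s, f k) = {w | ∀ k ∈ s, b k < T k w} := by
      ext w
      simp only [Set.mem_iInter, Set.mem_ofPred_eq]
      exact forall₂_congr fun k hk => by rw [hf' k hk]; rfl
    rw [← ENNReal.toReal_eq_toReal_iff' (measure_ne_top _ _)
      (ENNReal.prod_ne_top fun k _ => measure_ne_top _ _), ENNReal.toReal_prod, hI]
    refine (measureReal_forall_mem_lt hpos hsurv s b).trans (Finset.prod_congr rfl fun k hk => ?_)
    rw [hf' k hk]
    exact (measureReal_lt hpos hsurv k (b k)).symm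

end Exponential

section TwoState

/-- The successive states of the two-state source started in `i`, which alternate. -/
def alternating (i : Fin 2) : ℕ → Fin 2
  | 0 => i
  | n + 1 => 1 - alternating i n

/-- The rate at which the two-state source leaves a state. -/
def exitRate (α β : ℝ) : Fin 2 → ℝ := ![β, α]

lemma exitRate_pos {α β : ℝ} (hα : 0 < α) (hβ : 0 < β) (k : Fin 2) : 0 < exitRate α β k := by
  fin_cases k <;> simpa [exitRate]

lemma gen_diag (α β : ℝ) (k : Fin 2) : gen α β k k = -exitRate α β k := by
  fin_cases k <;> simp [gen, exitRate]

lemma jumpProb_gen {α β : ℝ} (hα : 0 < α) (hβ : 0 < β) (k : Fin 2) :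
    jumpProb (gen α β) k (1 - k) = 1 := by
  fin_cases k <;> simp [jumpProb, gen, hα.ne', hβ.ne']

lemma jumpProb_alternating {α β : ℝ} (hα : 0 < α) (hβ : 0 < β) (i : Fin 2) (k : ℕ) :
    jumpProb (gen α β) (alternating i k) (alternating i (k + 1)) = 1 :=
  jumpProb_gen hα hβ (alternating i k)

/-- The two-state source visits its states alternately, with independent exponential holding
times. -/
lemma IsCTMC.exists_holding {Ω : Type*} [MeasurableSpace Ω] {P : Measure Ω}
    [IsProbabilityMeasure P] {α β : ℝ} (hα : 0 < α) (hβ : 0 < β) {i : Fin 2} {I : ℝ → Ω → Fin 2}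
    (hI : IsCTMC P (gen α β) i I) :
    ∃ T : ℕ → Ω → ℝ, (∀ k, Measurable (T k)) ∧ iIndepFun T P ∧
      (∀ k, P.map (T k) = expMeasure (exitRate α β (alternating i k))) ∧
      (∀ᵐ w ∂P, ∀ k, 0 < T k w) ∧
      ∀ᵐ w ∂P, ∀ (n : ℕ) (t : ℝ), ∑ k ∈ Finset.range n, T k w ≤ t →
        t < ∑ k ∈ Finset.range (n + 1), T k w → I t w = alternating i n := by
  obtain ⟨Y, T, hY, hT, hlaw, hpath⟩ := hI
  have hlaw' : ∀ (n : ℕ) (t : ℕ → ℝ), (∀ k, 0 ≤ t k) →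
      P.real {w | ∀ k ≤ n, Y k w = alternating i k ∧ t k < T k w} =
        ∏ k ∈ Finset.range (n + 1), Real.exp (-exitRate α β (alternating i k) * t k) := by
    intro n t ht
    rw [hlaw n (alternating i) t ht, show alternating i 0 = i from rfl, if_pos rfl, one_mul,
      Finset.prod_eq_one fun k _ => jumpProb_alternating hα hβ i k, one_mul]
    simp only [gen_diag]
  have hmeas : ∀ n, MeasurableSet {w | ∀ k ≤ n, Y k w = alternating i k ∧ 0 < T k w} := by
    intro n
    simp only [Set.ofPred_forall]
    exact MeasurableSet.iInter fun k => MeasurableSet.iInter fun _ =>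
      (hY k _).inter (measurableSet_lt measurable_const (hT k))
  have hae : ∀ᵐ w ∂P, ∀ n, Y n w = alternating i n ∧ 0 < T n w := by
    refine ae_all_iff.2 fun n => ?_
    have h := hlaw' n 0 (fun _ => le_rfl)
    simp only [Pi.zero_apply, mul_zero, Real.exp_zero, Finset.prod_const_one] at h
    have : ∀ᵐ w ∂P, w ∈ {w | ∀ k ≤ n, Y k w = alternating i k ∧ 0 < T k w} := by
      refine (mem_ae_iff_prob_eq_one (hmeas n)).2 ?_
      rwa [← ENNReal.toReal_eq_one_iff]
    exact this.mono fun w hw => hw n le_rfl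
  have hpos : ∀ᵐ w ∂P, ∀ k, 0 < T k w := hae.mono fun w hw k => (hw k).2
  have hsurv : ∀ (n : ℕ) (t : ℕ → ℝ), (∀ k, 0 ≤ t k) →
      P.real {w | ∀ k ≤ n, t k < T k w} =
        ∏ k ∈ Finset.range (n + 1), Real.exp (-exitRate α β (alternating i k) * t k) := by
    intro n t ht
    rw [← hlaw' n t ht]
    refine measureReal_congr ?_
    filter_upwards [hae] with w hw
    exact propext ⟨fun h k hk => ⟨(hw k).1, h k hk⟩, fun h k hk => (h k hk).2⟩
  refine ⟨T, hT, iIndepFun_of_survival hT hpos hsurv,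
    map_eq_expMeasure (fun k => exitRate_pos hα hβ _) hT hpos hsurv, hpos, ?_⟩
  filter_upwards [hpath, hae] with w hw hw' n t h0 h1
  rw [hw n t h0 h1, (hw' n).1]

end TwoState

/-! ### First-step analysis over an exponential holding time -/

section Exponential

lemma integral_expMeasure {E : Type*} [NormedAddCommGroup E] [NormedSpace ℝ E] {q : ℝ} (hq : 0 < q)
    (f : ℝ → E) :
    ∫ t, f t ∂(expMeasure q) = ∫ t in Set.Ioi (0 : ℝ), (q * Real.exp (-(q * t))) • f t := by
  have h : expMeasure q = volume.withDensity (exponentialPDF q) := rfl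
  have hm : Measurable (exponentialPDF q) := (measurable_exponentialPDFReal q).ennreal_ofReal
  rw [h, integral_withDensity_eq_integral_toReal_smul hm (by simp [exponentialPDF]),
    ← integral_indicator measurableSet_Ioi]
  refine integral_congr_ae ?_
  filter_upwards [Measure.ae_ne volume (0 : ℝ)] with t ht
  rw [exponentialPDF_eq]
  rcases lt_or_gt_of_ne ht with h0 | h0
  · rw [if_neg h0.not_ge, Set.indicator_of_notMem (by simpa using h0.le)]
    simp
  · rw [if_pos h0.le, Set.indicator_of_mem (Set.mem_Ioi.2 h0),
      ENNReal.toReal_ofReal (by positivity)]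

instance noAtoms_expMeasure (q : ℝ) : NullSingletonClass (expMeasure q) :=
  inferInstanceAs (NullSingletonClass (volume.withDensity (exponentialPDF q)))

/-- The Laplace transform at `1`. -/
lemma mgf_expMeasure_neg_one {q : ℝ} (hq : 0 < q) :
    ∫ t, Real.exp (-1 * t) ∂(expMeasure q) = q / (q + 1) := by
  have h : ∀ t : ℝ, (q * Real.exp (-(q * t))) • Real.exp (-1 * t) =
      q * Real.exp (-(q + 1) * t) := fun t => by
    rw [smul_eq_mul, mul_assoc, ← Real.exp_add]; ring_nf
  rw [integral_expMeasure hq]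
  simp_rw [h]
  rw [integral_const_mul, integral_exp_mul_Ioi (by linarith)]
  rw [mul_zero, Real.exp_zero, neg_div_neg_eq, mul_one_div]

lemma mul_integral_cexp (z : ℂ) (c : ℝ) :
    z * ∫ t in (0 : ℝ)..c, Complex.exp (-z * t) = 1 - Complex.exp (-z * c) := by
  by_cases hz : z = 0
  · simp [hz]
  · rw [integral_exp_mul_complex (neg_ne_zero.2 hz)]
    field_simp
    simp

/-- First-step analysis over one holding time: with content `v > 0` at its start and net rate `ρ`,
the discounted value is `h exp (s v)`, provided that `(q + ω - ρ s) h = q h'`. -/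
lemma integral_first_step {q ρ v : ℝ} {ω s h h' : ℂ} (hq : 0 < q) (hω : 0 < ω.re) (hs : s.re ≤ 0)
    (hh : (q + ω - ρ * s) * h = q * h') (hv : 0 < v) :
    ∫ t : ℝ, (if v + ρ * t ≤ 0 then h * Complex.exp (-ω * ((v / -ρ : ℝ) : ℂ))
      else h' * Complex.exp (-ω * t + s * ((v + ρ * t : ℝ) : ℂ))) ∂(expMeasure q) =
      h * Complex.exp (s * v) := by
  rw [integral_expMeasure hq]
  -- the contributions of holding times that do not and that do empty the buffer
  have e1 : ∀ t : ℝ, (q * Real.exp (-(q * t))) •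
      (h' * Complex.exp (-ω * t + s * ((v + ρ * t : ℝ) : ℂ))) =
      (q * h' * Complex.exp (s * v)) * Complex.exp (-(q + ω - ρ * s) * t) := by
    intro t
    have : -(q + ω - ρ * s) * t = -(q * t) + (-ω * t + s * (ρ * t)) := by ring
    rw [Complex.real_smul, this]
    push_cast
    simp only [mul_add, Complex.exp_add]
    ring
  rcases le_or_gt 0 ρ with hρ | hρ
  · have hz : (-(q + ω - ρ * s)).re < 0 := by
      simp
      nlinarith [mul_nonpos_of_nonneg_of_nonpos hρ hs]
    have hz0 : (q + ω - ρ * s) ≠ 0 := by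
      intro h0; rw [h0] at hz; simp at hz
    rw [setIntegral_congr_fun (g := fun t : ℝ => (q * h' * Complex.exp (s * v)) *
      Complex.exp (-(q + ω - ρ * s) * t)) measurableSet_Ioi]
    · rw [integral_const_mul, integral_exp_mul_complex_Ioi hz]
      simp only [Complex.ofReal_zero, mul_zero, Complex.exp_zero]
      rw [← hh]
      field_simp
    · intro t ht
      have : ¬ v + ρ * t ≤ 0 := by
        have := mul_nonneg hρ (Set.mem_Ioi.1 ht).le
        linarith
      dsimp only
      rw [if_neg this, e1]
  · have hρ' : 0 < -ρ := neg_pos.2 hρ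
    obtain ⟨c, hc⟩ : ∃ c, c = v / -ρ := ⟨_, rfl⟩
    have hc0 : 0 < c := hc ▸ div_pos hv hρ'
    have hvc : v = -ρ * c := by rw [hc, mul_div_cancel₀ _ hρ'.ne']
    have hif : ∀ t, v + ρ * t ≤ 0 ↔ c ≤ t := by
      intro t
      rw [hvc]
      constructor <;> intro ht <;> nlinarith
    rw [← hc]
    have e2 : ∀ t : ℝ, (q * Real.exp (-(q * t))) • (h * Complex.exp (-ω * (c : ℂ))) =
        (q * h * Complex.exp (-ω * c)) * Complex.exp (-(q : ℂ) * t) := by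
      intro t
      rw [Complex.real_smul]
      push_cast
      rw [neg_mul (q : ℂ)]
      ring
    have i1 : IntegrableOn (fun t : ℝ => (q * h' * Complex.exp (s * v)) *
        Complex.exp (-(q + ω - ρ * s) * t)) (Set.Ioo 0 c) :=
      ((Continuous.integrableOn_Icc (by fun_prop)).mono_set Set.Ioo_subset_Icc_self)
    have i2 : IntegrableOn (fun t : ℝ => (q * h * Complex.exp (-ω * c)) *
        Complex.exp (-(q : ℂ) * t)) (Set.Ici c) := by
      rw [integrableOn_Ici_iff_integrableOn_Ioi]
      exact (integrableOn_exp_mul_complex_Ioi (by simpa using hq) c).const_mul _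
    have c1 : Set.EqOn (fun t : ℝ => (q * Real.exp (-(q * t))) •
        (if v + ρ * t ≤ 0 then h * Complex.exp (-ω * (c : ℂ))
          else h' * Complex.exp (-ω * t + s * ((v + ρ * t : ℝ) : ℂ))))
        (fun t : ℝ => (q * h' * Complex.exp (s * v)) *
          Complex.exp (-(q + ω - ρ * s) * t)) (Set.Ioo 0 c) := by
      intro t ht
      dsimp only
      rw [if_neg (by rw [hif]; exact ht.2.not_ge), e1]
    have c2 : Set.EqOn (fun t : ℝ => (q * Real.exp (-(q * t))) •
        (if v + ρ * t ≤ 0 then h * Complex.exp (-ω * (c : ℂ))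
          else h' * Complex.exp (-ω * t + s * ((v + ρ * t : ℝ) : ℂ))))
        (fun t : ℝ => (q * h * Complex.exp (-ω * c)) *
        Complex.exp (-(q : ℂ) * t)) (Set.Ici c) := by
      intro t ht
      dsimp only
      rw [if_pos (by rw [hif]; exact ht), e2]
    rw [← Set.Ioo_union_Ici_eq_Ioi hc0, setIntegral_union
      (Set.disjoint_left.2 fun t h1 h2 => h1.2.not_ge h2) measurableSet_Ici
      ((integrableOn_congr_fun c1 measurableSet_Ioo).2 i1)
      ((integrableOn_congr_fun c2 measurableSet_Ici).2 i2),
      setIntegral_congr_fun measurableSet_Ioo c1, setIntegral_congr_fun measurableSet_Ici c2,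
      integral_const_mul, integral_const_mul, ← integral_Ioc_eq_integral_Ioo,
      ← intervalIntegral.integral_of_le hc0.le, integral_Ici_eq_integral_Ioi,
      integral_exp_mul_complex_Ioi (by simpa using hq), ← hh]
    have hqC : (q : ℂ) ≠ 0 := by exact_mod_cast hq.ne'
    have hlast : (q * h * Complex.exp (-ω * c)) * (-Complex.exp (-(q : ℂ) * c) / -(q : ℂ)) =
        h * Complex.exp (s * v) * Complex.exp (-(q + ω - ρ * s) * c) := by
      rw [hvc, mul_assoc h (Complex.exp _), ← Complex.exp_add]
      push_cast
      rw [show s * (-ρ * c) + -(q + ω - ρ * s) * c = -ω * c + -(q : ℂ) * c by ring,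
        Complex.exp_add]
      field_simp
    rw [hlast]
    linear_combination h * Complex.exp (s * v) * mul_integral_cexp (q + ω - ρ * s) c

end Exponential

/-! ### Epochs and contents along independent holding times -/

section Renewal

variable {Ω : Type*} {T : ℕ → Ω → ℝ} {q ρ : ℕ → ℝ} {x : ℝ}

lemma measurable_epoch {m : MeasurableSpace Ω} {n : ℕ} (hT : ∀ k < n, Measurable[m] (T k)) :
    Measurable[m] (fun w => ∑ k ∈ Finset.range n, T k w) :=
  Finset.measurable_fun_sum _ fun k hk => hT k (Finset.mem_range.1 hk)

lemma measurable_killedContent {m : MeasurableSpace Ω} {n : ℕ}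
    (hT : ∀ k < n, Measurable[m] (T k)) :
    Measurable[m] (fun w => killedContent ρ (fun k => T k w) x n) := by
  induction n with
  | zero => exact measurable_const
  | succ n ih =>
    have ih' := ih fun k hk => hT k (hk.trans n.lt_succ_self)
    exact Measurable.ite (measurableSet_lt measurable_const ih')
      (measurable_const.max (ih'.add ((hT n n.lt_succ_self).const_mul (ρ n)))) measurable_const

variable [MeasurableSpace Ω] {P : Measure Ω}

/-- The `n`-th epoch and the content then are independent of the `n`-th holding time. -/
lemma indepFun_epoch_killedContent (hT : ∀ k, Measurable (T k)) (hind : iIndepFun T P) (n : ℕ) :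
    IndepFun (fun w => (∑ k ∈ Finset.range n, T k w, killedContent ρ (fun k => T k w) x n))
      (T n) P := by
  rw [IndepFun_iff_Indep]
  have h := indep_iSup_of_disjoint (fun k => (hT k).comap_le)
    ((iIndepFun_iff_iIndep _ _ _).1 hind) (S := Set.Iio n) (T := {n}) (by simp)
  have hle : ∀ k < n, Measurable[⨆ i ∈ Set.Iio n, MeasurableSpace.comap (T i) inferInstance]
      (T k) := fun k hk => (comap_measurable (T k)).mono
    (le_iSup₂_of_le (f := fun i (_ : i ∈ Set.Iio n) => MeasurableSpace.comap (T i) inferInstance)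
      k hk le_rfl) le_rfl
  refine indep_of_indep_of_le h ?_ (le_iSup₂_of_le
    (f := fun i (_ : i ∈ ({n} : Set ℕ)) => MeasurableSpace.comap (T i) inferInstance) n rfl le_rfl)
  exact ((measurable_epoch hle).prodMk (measurable_killedContent hle)).comap_le

/-- The jump epochs tend to infinity: since `E exp (-S n)` decays geometrically, the series
`∑ exp (-S n)` converges almost surely. -/
lemma tendsto_epoch_atTop [IsProbabilityMeasure P] (hT : ∀ k, Measurable (T k))
    (hind : iIndepFun T P)
    (hq : ∀ k, 0 < q k) (hlaw : ∀ k, P.map (T k) = expMeasure (q k))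
    {M : ℝ} (hM : ∀ k, q k ≤ M) :
    ∀ᵐ w ∂P, Filter.Tendsto (fun n => ∑ k ∈ Finset.range n, T k w) Filter.atTop Filter.atTop := by
  have hM0 : 0 < M := (hq 0).trans_le (hM 0)
  have hmgf : ∀ k, mgf (T k) P (-1) = q k / (q k + 1) := by
    intro k
    rw [← mgf_expMeasure_neg_one (hq k), ← hlaw k,
      integral_map (hT k).aemeasurable (by fun_prop), mgf]
  have hE : ∀ n, ∫⁻ w, ENNReal.ofReal (Real.exp (-1 * ∑ k ∈ Finset.range n, T k w)) ∂P ≤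
      ENNReal.ofReal ((M / (M + 1)) ^ n) := by
    intro n
    have h := hind.mgf_sum (t := -1) hT (Finset.range n)
    have hint : Integrable (fun w => Real.exp (-1 * ∑ k ∈ Finset.range n, T k w)) P := by
      have := hind.integrable_exp_mul_sum (t := -1) hT (s := Finset.range n) fun k _ => by
        refine not_not.1 fun hni => ?_
        have h0 := hmgf k
        rw [mgf, integral_undef hni] at h0
        have : 0 < q k / (q k + 1) := div_pos (hq k) (by linarith [hq k])
        linarith
      simpa using this
    rw [← ofReal_integral_eq_lintegral_ofReal hint
      (Filter.Eventually.of_forall fun w => by positivity)]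
    refine ENNReal.ofReal_le_ofReal ?_
    have h' : ∫ w, Real.exp (-1 * ∑ k ∈ Finset.range n, T k w) ∂P =
        ∏ k ∈ Finset.range n, (q k / (q k + 1)) := by
      simp_rw [← hmgf, ← h, mgf, Finset.sum_apply]
    rw [h']
    calc ∏ k ∈ Finset.range n, (q k / (q k + 1)) ≤ ∏ k ∈ Finset.range n, (M / (M + 1)) := by
          refine Finset.prod_le_prod (fun k _ => (div_pos (hq k) (by linarith [hq k])).le)
            fun k _ => ?_
          rw [div_le_div_iff₀ (by linarith [hq k]) (by linarith)]
          nlinarith [hM k]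
      _ = (M / (M + 1)) ^ n := by rw [Finset.prod_const, Finset.card_range]
  have hsum : ∑' n, ∫⁻ w, ENNReal.ofReal (Real.exp (-1 * ∑ k ∈ Finset.range n, T k w)) ∂P ≠ ⊤ := by
    refine ne_top_of_le_ne_top ?_ (ENNReal.tsum_le_tsum hE)
    have hr0 : 0 ≤ M / (M + 1) := by positivity
    have hr1 : M / (M + 1) < 1 := by rw [div_lt_one (by linarith)]; linarith
    rw [← ENNReal.ofReal_tsum_of_nonneg (fun n => by positivity)
      (summable_geometric_of_lt_one hr0 hr1)]
    exact ENNReal.ofReal_ne_top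
  have hmeas : ∀ n, Measurable fun w =>
      ENNReal.ofReal (Real.exp (-1 * ∑ k ∈ Finset.range n, T k w)) := fun n =>
    (((measurable_epoch fun k _ => hT k).const_mul _).exp).ennreal_ofReal
  rw [← lintegral_tsum fun n => (hmeas n).aemeasurable] at hsum
  filter_upwards [ae_lt_top (Measurable.tsum hmeas) hsum] with w hw
  have h0 := ENNReal.tendsto_atTop_zero_of_tsum_ne_top hw.ne
  have h1 := (ENNReal.tendsto_toReal ENNReal.zero_ne_top).comp h0
  have h2 : Filter.Tendsto (fun n => Real.exp (-∑ k ∈ Finset.range n, T k w)) Filter.atTop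
      (nhds 0) := by
    simpa [Function.comp_def, ENNReal.toReal_ofReal (Real.exp_pos _).le] using h1
  simpa [Function.comp_def] using
    Filter.tendsto_neg_atBot_atTop.comp (Real.tendsto_exp_comp_nhds_zero.1 h2)

/-- Almost surely the buffer does not empty exactly at a jump epoch. -/
lemma killedContent_add_ne_zero [IsProbabilityMeasure P] (hT : ∀ k, Measurable (T k))
    (hind : iIndepFun T P) (hq : ∀ k, 0 < q k) (hlaw : ∀ k, P.map (T k) = expMeasure (q k)) :
    ∀ᵐ w ∂P, ∀ n, 0 < killedContent ρ (fun k => T k w) x n →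
      killedContent ρ (fun k => T k w) x n + ρ n * T n w ≠ 0 := by
  refine ae_all_iff.2 fun n => ?_
  by_cases hρ : ρ n = 0
  · refine Filter.Eventually.of_forall fun w hw => ?_
    rw [hρ, zero_mul, add_zero]
    exact hw.ne'
  · have := isProbabilityMeasure_expMeasure (hq n)
    have hV : Measurable (fun w => killedContent ρ (fun k => T k w) x n) :=
      measurable_killedContent fun k _ => hT k
    have hind' : IndepFun (fun w => killedContent ρ (fun k => T k w) x n) (T n) P :=
      (indepFun_epoch_killedContent hT hind n).comp measurable_snd measurable_id
    have hmap := hind'.map_prod_eq_prod_map_map hV.aemeasurable (hT n).aemeasurable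
    have hset : MeasurableSet {p : ℝ × ℝ | p.1 + ρ n * p.2 = 0} :=
      measurableSet_eq_fun (by fun_prop) measurable_const
    have h0 : ((P.map (fun w => killedContent ρ (fun k => T k w) x n)).prod (P.map (T n)))
        {p : ℝ × ℝ | p.1 + ρ n * p.2 = 0} = 0 := by
      rw [hlaw n, Measure.measure_prod_null hset]
      refine Filter.Eventually.of_forall fun v => ?_
      refine measure_mono_null (t := {-v / ρ n}) (fun t ht => ?_) (measure_singleton _)
      have ht : v + ρ n * t = 0 := ht
      rw [Set.mem_singleton_iff, eq_div_iff hρ]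
      linarith
    rw [← hmap, Measure.map_apply (hV.prodMk (hT n)) hset] at h0
    have h1 : ∀ᵐ w ∂P, w ∉ (fun w => (killedContent ρ (fun k => T k w) x n, T n w)) ⁻¹'
        {p : ℝ × ℝ | p.1 + ρ n * p.2 = 0} := measure_eq_zero_iff_ae_notMem.1 h0
    filter_upwards [h1] with w hw _
    exact hw

end Renewal

/-! ### Optional stopping at the starvation time -/

section Martingale

variable {Ω : Type*} {T : ℕ → Ω → ℝ} {q ρ : ℕ → ℝ} {x : ℝ} {ω s : ℂ}

/-- The event that the buffer empties during the `n`-th holding time. -/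
def starvesIn (ρ : ℕ → ℝ) (T : ℕ → Ω → ℝ) (x : ℝ) (n : ℕ) : Set Ω :=
  {w | 0 < killedContent ρ (fun k => T k w) x n ∧
    killedContent ρ (fun k => T k w) x n + ρ n * T n w ≤ 0}

/-- The time at which the buffer empties, on the event that this happens during the `n`-th holding
time. -/
def starvesAt (ρ : ℕ → ℝ) (T : ℕ → Ω → ℝ) (x : ℝ) (n : ℕ) (w : Ω) : ℝ :=
  ∑ k ∈ Finset.range n, T k w + killedContent ρ (fun k => T k w) x n / -ρ n

/-- `exp (-ω S + s X)` at the `n`-th jump epoch `S`, where `X` is the content, on the event that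
the buffer has not been empty; `0` otherwise. -/
def aliveWeight (ρ : ℕ → ℝ) (T : ℕ → Ω → ℝ) (x : ℝ) (ω s : ℂ) (n : ℕ) (w : Ω) : ℂ :=
  if 0 < killedContent ρ (fun k => T k w) x n then
    Complex.exp (-ω * ((∑ k ∈ Finset.range n, T k w : ℝ) : ℂ) +
      s * (killedContent ρ (fun k => T k w) x n : ℂ)) else 0

lemma starvesAt_nonneg {n : ℕ} {w : Ω} (hT : ∀ k, 0 < T k w) (hw : w ∈ starvesIn ρ T x n) :
    0 ≤ starvesAt ρ T x n w := by
  obtain ⟨h1, h2⟩ := hw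
  have hr : 0 ≤ -ρ n := by
    by_contra h
    nlinarith [hT n]
  exact add_nonneg (epoch_nonneg hT n) (div_nonneg h1.le hr)

lemma norm_cexp_neg_mul_le_one (hω : 0 ≤ ω.re) {t : ℝ} (ht : 0 ≤ t) :
    ‖Complex.exp (-ω * t)‖ ≤ 1 := by
  rw [Complex.norm_exp, Real.exp_le_one_iff]
  simpa using mul_nonneg hω ht

lemma norm_aliveWeight_le (hs : s.re ≤ 0) (n : ℕ) (w : Ω) :
    ‖aliveWeight ρ T x ω s n w‖ ≤ Real.exp (-(ω.re * ∑ k ∈ Finset.range n, T k w)) := by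
  rw [aliveWeight]
  split_ifs with h
  · rw [Complex.norm_exp]
    refine Real.exp_le_exp.2 ?_
    have := mul_nonpos_of_nonpos_of_nonneg hs h.le
    rw [Complex.add_re, Complex.re_mul_ofReal, Complex.re_mul_ofReal, Complex.neg_re]
    linarith
  · simp [Real.exp_nonneg]

variable [MeasurableSpace Ω] {P : Measure Ω}

lemma measurableSet_starvesIn (hT : ∀ k, Measurable (T k)) (n : ℕ) :
    MeasurableSet (starvesIn ρ T x n) := by
  have hV : Measurable (fun w => killedContent ρ (fun k => T k w) x n) :=
    measurable_killedContent fun k _ => hT k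
  exact (measurableSet_lt measurable_const hV).inter
    (measurableSet_le (hV.add ((hT n).const_mul _)) measurable_const)

lemma measurable_starvesAt (hT : ∀ k, Measurable (T k)) (n : ℕ) :
    Measurable (starvesAt ρ T x n) :=
  (measurable_epoch fun k _ => hT k).add
    ((measurable_killedContent fun k _ => hT k).div_const _)

lemma measurable_aliveWeight (hT : ∀ k, Measurable (T k)) (n : ℕ) :
    Measurable (aliveWeight ρ T x ω s n) := by
  have hV : Measurable (fun w => killedContent ρ (fun k => T k w) x n) :=
    measurable_killedContent fun k _ => hT k
  have hS : Measurable (fun w => ∑ k ∈ Finset.range n, T k w) := measurable_epoch fun k _ => hT k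
  exact Measurable.ite (measurableSet_lt measurable_const hV) (by fun_prop) measurable_const

lemma integrable_aliveWeight [IsProbabilityMeasure P] (hT : ∀ k, Measurable (T k))
    (hpos : ∀ᵐ w ∂P, ∀ k, 0 < T k w) (hω : 0 < ω.re) (hs : s.re ≤ 0) (n : ℕ) :
    Integrable (aliveWeight ρ T x ω s n) P := by
  refine Integrable.of_bound (measurable_aliveWeight hT n).aestronglyMeasurable 1 ?_
  filter_upwards [hpos] with w hw
  refine (norm_aliveWeight_le hs n w).trans (Real.exp_le_one_iff.2 ?_)
  exact neg_nonpos.2 (mul_nonneg hω.le (epoch_nonneg hw n))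

lemma integrableOn_discount [IsProbabilityMeasure P] (hT : ∀ k, Measurable (T k))
    (hpos : ∀ᵐ w ∂P, ∀ k, 0 < T k w) (hω : 0 < ω.re) (n : ℕ) :
    IntegrableOn (fun w => Complex.exp (-ω * (starvesAt ρ T x n w : ℂ))) (starvesIn ρ T x n) P := by
  have hm := measurable_starvesAt (ρ := ρ) (x := x) hT n
  refine Integrable.of_bound (Measurable.aestronglyMeasurable (by fun_prop)) 1 ?_
  filter_upwards [ae_restrict_of_ae hpos, ae_restrict_mem (measurableSet_starvesIn hT n)]
    with w hw hw'
  exact norm_cexp_neg_mul_le_one hω.le (starvesAt_nonneg hw hw')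

/-- The martingale step: conditionally on the first `n` holding times, this is first-step analysis
over the next one. -/
lemma integral_discount_add [IsProbabilityMeasure P] (hT : ∀ k, Measurable (T k))
    (hind : iIndepFun T P) (hq : ∀ k, 0 < q k) (hlaw : ∀ k, P.map (T k) = expMeasure (q k))
    (hpos : ∀ᵐ w ∂P, ∀ k, 0 < T k w) (hω : 0 < ω.re) (hs : s.re ≤ 0) {h : ℕ → ℂ}
    (hh : ∀ k, (q k + ω - ρ k * s) * h k = q k * h (k + 1)) (n : ℕ) :
    h n * ∫ w in starvesIn ρ T x n, Complex.exp (-ω * (starvesAt ρ T x n w : ℂ)) ∂P +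
      h (n + 1) * ∫ w, aliveWeight ρ T x ω s (n + 1) w ∂P =
      h n * ∫ w, aliveWeight ρ T x ω s n w ∂P := by
  have hV : Measurable (fun w => killedContent ρ (fun k => T k w) x n) :=
    measurable_killedContent fun k _ => hT k
  have hS : Measurable (fun w => ∑ k ∈ Finset.range n, T k w) := measurable_epoch fun k _ => hT k
  have hE := measurableSet_starvesIn (ρ := ρ) (x := x) hT n
  have i1 := integrableOn_discount (ρ := ρ) (x := x) hT hpos hω n
  have i2 := integrable_aliveWeight (ρ := ρ) (x := x) hT hpos hω hs (n + 1)
  obtain ⟨g, hg⟩ : ∃ g : ℝ → ℝ → ℂ, g = fun v t =>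
      if v + ρ n * t ≤ 0 then h n * Complex.exp (-ω * ((v / -ρ n : ℝ) : ℂ))
      else h (n + 1) * Complex.exp (-ω * t + s * ((v + ρ n * t : ℝ) : ℂ)) := ⟨_, rfl⟩
  obtain ⟨φ, hφ⟩ : ∃ φ : (ℝ × ℝ) × ℝ → ℂ, φ = fun p =>
      if 0 < p.1.2 then Complex.exp (-ω * (p.1.1 : ℂ)) * g p.1.2 p.2 else 0 := ⟨_, rfl⟩
  have hφm : Measurable φ := by
    rw [hφ, hg]
    refine Measurable.ite (measurableSet_lt measurable_const (by fun_prop))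
      (Measurable.mul (by fun_prop) (Measurable.ite (measurableSet_le (by fun_prop)
        measurable_const) ?_ ?_)) measurable_const
    · have : Measurable fun a : (ℝ × ℝ) × ℝ => a.1.2 / -ρ n :=
        (measurable_snd.comp measurable_fst).div_const _
      fun_prop
    · fun_prop
  -- the two integrands on the left, combined, as a function of the past and of the holding time
  have hpt : ∀ w, h n * (starvesIn ρ T x n).indicator
      (fun w => Complex.exp (-ω * (starvesAt ρ T x n w : ℂ))) w +
      h (n + 1) * aliveWeight ρ T x ω s (n + 1) w =
      φ ((∑ k ∈ Finset.range n, T k w, killedContent ρ (fun k => T k w) x n), T n w) := by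
    intro w
    classical
    rw [hφ, hg, aliveWeight, killedContent_succ, Set.indicator_apply]
    dsimp only
    by_cases hv : 0 < killedContent ρ (fun k => T k w) x n
    · by_cases hd : killedContent ρ (fun k => T k w) x n + ρ n * T n w ≤ 0
      · rw [if_pos (show w ∈ starvesIn ρ T x n from ⟨hv, hd⟩), if_pos hv, if_pos hv, if_pos hd,
          max_eq_left hd, if_neg (lt_irrefl _), starvesAt]
        push_cast
        rw [mul_add, Complex.exp_add]
        ring
      · rw [if_neg (show w ∉ starvesIn ρ T x n from fun h => hd h.2), if_pos hv, if_pos hv,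
          if_neg hd, max_eq_right (not_le.1 hd).le, if_pos (not_le.1 hd), Finset.sum_range_succ,
          mul_left_comm, ← Complex.exp_add, mul_zero, zero_add]
        push_cast
        ring_nf
    · rw [if_neg (show w ∉ starvesIn ρ T x n from fun h => hv h.1), if_neg hv, if_neg hv,
        if_neg (lt_irrefl _)]
      simp
  have hint : Integrable (fun w =>
      φ ((∑ k ∈ Finset.range n, T k w, killedContent ρ (fun k => T k w) x n), T n w)) P := by
    simp_rw [← hpt]
    exact ((i1.integrable_indicator hE).const_mul _).add (i2.const_mul _)
  have hmap := (indepFun_epoch_killedContent (ρ := ρ) (x := x) hT hind n).map_prod_eq_prod_map_map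
    (hS.prodMk hV).aemeasurable (hT n).aemeasurable
  have hZ := ((hS.prodMk hV).prodMk (hT n))
  have hintm : Integrable φ ((P.map (fun w => (∑ k ∈ Finset.range n, T k w,
      killedContent ρ (fun k => T k w) x n))).prod (P.map (T n))) := by
    rw [← hmap]
    exact (integrable_map_measure hφm.aestronglyMeasurable hZ.aemeasurable).2 hint
  have := isProbabilityMeasure_expMeasure (hq n)
  calc _ = ∫ w, φ ((∑ k ∈ Finset.range n, T k w,
        killedContent ρ (fun k => T k w) x n), T n w) ∂P := by
        simp_rw [← hpt]
        rw [integral_add ((i1.integrable_indicator hE).const_mul _) (i2.const_mul _),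
          integral_const_mul, integral_const_mul, integral_indicator hE]
    _ = ∫ p, φ p ∂((P.map (fun w => (∑ k ∈ Finset.range n, T k w,
        killedContent ρ (fun k => T k w) x n))).prod (P.map (T n))) := by
        rw [← hmap, integral_map hZ.aemeasurable hφm.aestronglyMeasurable]
    _ = ∫ p, ∫ t, φ (p, t) ∂(P.map (T n)) ∂(P.map (fun w => (∑ k ∈ Finset.range n, T k w,
        killedContent ρ (fun k => T k w) x n))) := integral_prod _ hintm
    _ = ∫ p : ℝ × ℝ, (if 0 < p.2 then Complex.exp (-ω * (p.1 : ℂ)) *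
          (h n * Complex.exp (s * p.2)) else 0)
          ∂(P.map (fun w => (∑ k ∈ Finset.range n, T k w,
          killedContent ρ (fun k => T k w) x n))) := by
        refine integral_congr_ae (Filter.Eventually.of_forall fun p => ?_)
        dsimp only
        rw [hφ, hlaw n]
        dsimp only
        split_ifs with hv
        · rw [integral_const_mul, hg, integral_first_step (hq n) hω hs (hh n) hv]
        · exact integral_zero _ _
    _ = h n * ∫ w, aliveWeight ρ T x ω s n w ∂P := by
        rw [integral_map (hS.prodMk hV).aemeasurable, ← integral_const_mul]
        · refine integral_congr_ae (Filter.Eventually.of_forall fun w => ?_)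
          dsimp only
          rw [aliveWeight, mul_ite, mul_zero, Complex.exp_add, mul_left_comm]
        · refine (Measurable.ite (measurableSet_lt measurable_const (by fun_prop))
            (by fun_prop) measurable_const).aestronglyMeasurable

/-- If `(q k + ω - ρ k s) h k = q k h (k + 1)` and `Re s ≤ 0`, the expectation of `exp (-ω τ) h`,
with `h` taken in the state where the buffer empties, is `h 0 exp (s x)`. -/
lemma tendsto_sum_discount [IsProbabilityMeasure P] (hT : ∀ k, Measurable (T k))
    (hind : iIndepFun T P) (hq : ∀ k, 0 < q k) (hlaw : ∀ k, P.map (T k) = expMeasure (q k))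
    (hpos : ∀ᵐ w ∂P, ∀ k, 0 < T k w) {M : ℝ} (hM : ∀ k, q k ≤ M) (hx : 0 < x)
    (hω : 0 < ω.re) (hs : s.re ≤ 0) {h : ℕ → ℂ} {C : ℝ} (hC : ∀ k, ‖h k‖ ≤ C)
    (hh : ∀ k, (q k + ω - ρ k * s) * h k = q k * h (k + 1)) :
    Filter.Tendsto (fun n => ∑ k ∈ Finset.range n, h k *
      ∫ w in starvesIn ρ T x k, Complex.exp (-ω * (starvesAt ρ T x k w : ℂ)) ∂P) Filter.atTop
      (nhds (h 0 * Complex.exp (s * x))) := by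
  have hsum : ∀ n, ∑ k ∈ Finset.range n, h k *
      ∫ w in starvesIn ρ T x k, Complex.exp (-ω * (starvesAt ρ T x k w : ℂ)) ∂P =
      h 0 * Complex.exp (s * x) - h n * ∫ w, aliveWeight ρ T x ω s n w ∂P := by
    intro n
    induction n with
    | zero => simp [aliveWeight, killedContent, hx]
    | succ n ih =>
      rw [Finset.sum_range_succ, ih]
      linear_combination integral_discount_add (x := x) hT hind hq hlaw hpos hω hs hh n
  simp_rw [hsum]
  have hlim : Filter.Tendsto (fun n => ∫ w, aliveWeight ρ T x ω s n w ∂P) Filter.atTop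
      (nhds 0) := by
    rw [← integral_zero Ω ℂ (μ := P)]
    refine tendsto_integral_of_dominated_convergence (fun _ => 1)
      (fun n => (measurable_aliveWeight hT n).aestronglyMeasurable) (integrable_const _)
      (fun n => ?_) ?_
    · filter_upwards [hpos] with w hw
      refine (norm_aliveWeight_le hs n w).trans (Real.exp_le_one_iff.2 ?_)
      exact neg_nonpos.2 (mul_nonneg hω.le (epoch_nonneg hw n))
    · filter_upwards [tendsto_epoch_atTop hT hind hq hlaw hM] with w hw
      exact squeeze_zero_norm (fun n => norm_aliveWeight_le hs n w)
        (Real.tendsto_exp_neg_atTop_nhds_zero.comp (hw.const_mul_atTop hω))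
  have hlim' : Filter.Tendsto (fun n => h n * ∫ w, aliveWeight ρ T x ω s n w ∂P) Filter.atTop
      (nhds 0) := by
    refine squeeze_zero_norm (a := fun n => C * ‖∫ w, aliveWeight ρ T x ω s n w ∂P‖)
      (fun n => ?_) (by simpa using hlim.norm.const_mul C)
    rw [norm_mul]
    exact mul_le_mul_of_nonneg_right (hC n) (norm_nonneg _)
  simpa using hlim'.const_sub (h 0 * Complex.exp (s * x))

end Martingale

/-! ### The Laplace–Stieltjes transform of the starvation time -/

section Stieltjes

/-- A finite measure on `ℝ` is recovered from its distribution function. -/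
lemma stieltjesFunction_measure_eq {ν : Measure ℝ} [IsFiniteMeasure ν] {F : ℝ → ℝ} (hF : Monotone F)
    (h : ∀ t, F t = ν.real (Set.Iic t)) : hF.stieltjesFunction.measure = ν := by
  have hval : ∀ a, hF.stieltjesFunction a = ν.real (Set.Iic a) := by
    intro a
    -- the Stieltjes function is the right limit of `F`, which is already right-continuous
    rw [hF.stieltjesFunction_eq]
    have h1 := tendsto_measure_biInter_gt (μ := ν) (s := fun r : ℝ => Set.Iic r) (a := a)
      (fun r _ => measurableSet_Iic.nullMeasurableSet) (fun i j _ hij => Set.Iic_subset_Iic.2 hij)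
      ⟨a + 1, by simp, measure_ne_top _ _⟩
    have hset : (⋂ r > a, Set.Iic r) = Set.Iic a := by
      ext t
      simp only [Set.mem_iInter, Set.mem_Iic]
      exact ⟨fun ht => le_of_forall_gt_imp_ge_of_dense ht, fun ht r hr => ht.trans hr.le⟩
    rw [hset] at h1
    have h2 := (ENNReal.tendsto_toReal (measure_ne_top ν (Set.Iic a))).comp h1
    refine tendsto_nhds_unique (hF.tendsto_rightLim a) (h2.congr fun t => ?_)
    rw [h t]; rfl
  refine Measure.ext_of_Ioc _ _ fun a b hab => ?_
  rw [StieltjesFunction.measure_Ioc, hval, hval, ← Set.Iic_sdiff_Iic,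
    ← measureReal_sdiff (Set.Iic_subset_Iic.2 hab.le) measurableSet_Iic, ofReal_measureReal]

end Stieltjes

section Transform

variable {Ω S : Type*} [MeasurableSpace Ω] [DecidableEq S] {P : Measure Ω} {T : ℕ → Ω → ℝ}
  {r : S → ℝ} {y : ℕ → S} {x : ℝ} {ω : ℂ} {I : ℝ → Ω → S} {q : ℕ → ℝ}

/-- The transform of the starvation time on `{I τ = j}` splits according to the holding time
during which the buffer empties. -/
lemma hasSum_starvationLST [IsProbabilityMeasure P] (hT : ∀ k, Measurable (T k))
    (hind : iIndepFun T P) (hq : ∀ k, 0 < q k) (hlaw : ∀ k, P.map (T k) = expMeasure (q k))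
    (hpos : ∀ᵐ w ∂P, ∀ k, 0 < T k w) {M : ℝ} (hM : ∀ k, q k ≤ M) (hx : 0 < x)
    (hI : ∀ᵐ w ∂P, ∀ (n : ℕ) (t : ℝ), ∑ k ∈ Finset.range n, T k w ≤ t →
        t < ∑ k ∈ Finset.range (n + 1), T k w → I t w = y n)
    (hω : 0 < ω.re) (j : S) :
    HasSum (fun k => if y k = j then
      ∫ w in starvesIn (fun k => r (y k)) T x k,
        Complex.exp (-ω * (starvesAt (fun k => r (y k)) T x k w : ℂ)) ∂P else 0)
      (starvationLST P r I j x ω) := by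
  set E := starvesIn (fun k => r (y k)) T x
  set τ := starvesAt (fun k => r (y k)) T x
  have hE : ∀ k, MeasurableSet (E k) := measurableSet_starvesIn hT
  have hτ : ∀ k, Measurable (τ k) := measurable_starvesAt hT
  obtain ⟨A, hA⟩ : ∃ A : ℕ → Set Ω, A = fun k => {w | y k = j ∧ w ∈ E k} := ⟨_, rfl⟩
  have hAm : ∀ k, MeasurableSet (A k) := fun k => by
    rw [hA]; exact (MeasurableSet.const _).inter (hE k)
  have hAE : ∀ k, A k ⊆ E k := fun k w hw => by rw [hA] at hw; exact hw.2
  have hdisj : Pairwise (Function.onFun Disjoint A) := by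
    intro m n hmn
    refine Set.disjoint_left.2 fun w hm hn => hmn ?_
    exact starvation_step_unique (hAE m hm).1 (hAE m hm).2 (hAE n hn).1 (hAE n hn).2
  -- the law of the starvation time on the event `I τ = j`
  obtain ⟨ν, hν⟩ : ∃ ν, ν = Measure.sum fun k => (P.restrict (A k)).map (τ k) := ⟨_, rfl⟩
  have hνs : ∀ s, MeasurableSet s → ν s = P (⋃ k, τ k ⁻¹' s ∩ A k) := by
    intro s hs
    rw [hν, Measure.sum_apply _ hs, measure_iUnion
      (fun m n hmn => (hdisj hmn).mono Set.inter_subset_right Set.inter_subset_right)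
      (fun k => (hτ k hs).inter (hAm k))]
    refine tsum_congr fun k => ?_
    rw [Measure.map_apply (hτ k) hs, Measure.restrict_apply (hτ k hs)]
  have : IsFiniteMeasure ν := ⟨by
    rw [hνs _ MeasurableSet.univ]; exact measure_lt_top _ _⟩
  have hF : ∀ t, starvationProb P r I j x t = ν.real (Set.Iic t) := by
    intro t
    rw [measureReal_def, hνs _ measurableSet_Iic, ← measureReal_def, starvationProb]
    refine measureReal_congr ?_
    filter_upwards [hpos, hI, tendsto_epoch_atTop hT hind hq hlaw hM,
      killedContent_add_ne_zero (x := x) (ρ := fun k => r (y k)) hT hind hq hlaw]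
      with w h1 h2 h3 h4
    have h := starvation_iff hx h1 h2 h3 h4 j t
    refine propext (h.trans ?_)
    change _ ↔ w ∈ ⋃ k, τ k ⁻¹' Set.Iic t ∩ A k
    rw [Set.mem_iUnion, hA]
    refine exists_congr fun n => ?_
    rw [← and_assoc]
    exact and_comm
  have hpos' : ∀ᵐ t ∂ν, t ∈ Set.Ici (0 : ℝ) := by
    rw [hν]
    refine (Measure.ae_sum_iff' measurableSet_Ici).2 fun k => ?_
    refine (ae_map_iff (hτ k).aemeasurable measurableSet_Ici).2 ?_
    filter_upwards [ae_restrict_of_ae hpos, ae_restrict_mem (hAm k)] with w hw hw'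
    exact starvesAt_nonneg hw (hAE k hw')
  have hm : Measurable fun t : ℝ => Complex.exp (-ω * t) := by fun_prop
  have hint : Integrable (fun t : ℝ => Complex.exp (-ω * t)) ν := by
    refine Integrable.of_bound hm.aestronglyMeasurable 1 ?_
    filter_upwards [hpos'] with t ht
    exact norm_cexp_neg_mul_le_one hω.le ht
  have hlst : starvationLST P r I j x ω = ∫ t : ℝ, Complex.exp (-ω * t) ∂ν := by
    rw [starvationLST, stieltjesFunction_measure_eq _ hF, Measure.restrict_eq_self_of_ae_mem hpos']
  rw [hlst]
  rw [hν] at hint ⊢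
  have hterm : ∀ k, ∫ t : ℝ, Complex.exp (-ω * t) ∂((P.restrict (A k)).map (τ k)) =
      if y k = j then ∫ w in E k, Complex.exp (-ω * (τ k w : ℂ)) ∂P else 0 := by
    intro k
    rw [integral_map (hτ k).aemeasurable hm.aestronglyMeasurable, hA]
    by_cases hk : y k = j <;> simp [hk]
  have hs := hasSum_integral_measure hint
  simp_rw [hterm] at hs
  exact hs

/-- Starvation does not occur in a state in which the buffer does not empty. -/
lemma starvationLST_eq_zero [IsProbabilityMeasure P] (hT : ∀ k, Measurable (T k))
    (hind : iIndepFun T P) (hq : ∀ k, 0 < q k) (hlaw : ∀ k, P.map (T k) = expMeasure (q k))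
    (hpos : ∀ᵐ w ∂P, ∀ k, 0 < T k w) {M : ℝ} (hM : ∀ k, q k ≤ M) (hx : 0 < x)
    (hI : ∀ᵐ w ∂P, ∀ (n : ℕ) (t : ℝ), ∑ k ∈ Finset.range n, T k w ≤ t →
        t < ∑ k ∈ Finset.range (n + 1), T k w → I t w = y n)
    (hω : 0 < ω.re) {j : S} (hj : 0 ≤ r j) :
    starvationLST P r I j x ω = 0 := by
  refine (hasSum_starvationLST (r := r) hT hind hq hlaw hpos hM hx hI hω j).unique ?_
  convert hasSum_zero with k
  split_ifs with hk
  · refine setIntegral_measure_zero _ (measure_eq_zero_iff_ae_notMem.2 ?_)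
    filter_upwards [hpos] with w hw hw'
    have h1 := hw'.1
    have h2 : _ + r (y k) * T k w ≤ 0 := hw'.2
    rw [hk] at h2
    have := mul_nonneg hj (hw k).le
    linarith
  · rfl

end Transform

section TwoState

variable {Ω : Type*} [MeasurableSpace Ω] {P : Measure Ω} [IsProbabilityMeasure P]
  {α β l₁ l₂ μ x : ℝ} {ω s : ℂ} {i : Fin 2} {I : ℝ → Ω → Fin 2}

/-- The eigenvector of the pencil `Q + s R - ω` for a root `s` of its determinant. -/
def eigenvec (β l₂ μ : ℝ) (ω s : ℂ) : Fin 2 → ℂ := ![1, (β + ω - (l₂ - μ) * s) / β]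

lemma eigenvec_eq (hβ : 0 < β) (h : charDet α β l₁ l₂ μ s ω = 0) (k : Fin 2) :
    (exitRate α β k + ω - rate l₁ l₂ μ k * s) * eigenvec β l₂ μ ω s k =
      exitRate α β k * eigenvec β l₂ μ ω s (1 - k) := by
  have hβ' : (β : ℂ) ≠ 0 := by exact_mod_cast hβ.ne'
  rw [charDet_eq_zero_iff] at h
  fin_cases k
  · simp [exitRate, rate, eigenvec]
    field_simp
  · simp [exitRate, rate, eigenvec]
    field_simp
    linear_combination h

lemma exitRate_le (hα : 0 < α) (hβ : 0 < β) (k : Fin 2) : exitRate α β k ≤ α + β := by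
  fin_cases k
  · simpa [exitRate] using hα.le
  · simpa [exitRate] using hβ.le

/-- The linear relation between the two transforms that each root in the left half-plane gives. -/
lemma starvationLST_relation (hα : 0 < α) (hβ : 0 < β) (hI : IsCTMC P (gen α β) i I) (hx : 0 < x)
    (hω : 0 < ω.re) (hs : s.re ≤ 0) (h : charDet α β l₁ l₂ μ s ω = 0) :
    starvationLST P (rate l₁ l₂ μ) I state2 x ω +
      (β + ω - (l₂ - μ) * s) / β * starvationLST P (rate l₁ l₂ μ) I state1 x ω =
      Complex.exp (s * x) * eigenvec β l₂ μ ω s i := by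
  obtain ⟨T, hT, hind, hlaw, hpos, hpath⟩ := hI.exists_holding hα hβ
  have hq : ∀ k, 0 < exitRate α β (alternating i k) := fun k => exitRate_pos hα hβ _
  have hM : ∀ k, exitRate α β (alternating i k) ≤ α + β := fun k => exitRate_le hα hβ _
  have hsum := fun j => hasSum_starvationLST (r := rate l₁ l₂ μ) hT hind hq hlaw hpos hM hx hpath
    hω j
  have h2 := ((hsum state2).add ((hsum state1).mul_left
    ((β + ω - (l₂ - μ) * s) / β))).tendsto_sum_nat
  have h1 := tendsto_sum_discount (ρ := fun k => rate l₁ l₂ μ (alternating i k)) hT hind hq hlaw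
    hpos hM hx hω hs (h := fun k => eigenvec β l₂ μ ω s (alternating i k))
    (C := max ‖eigenvec β l₂ μ ω s 0‖ ‖eigenvec β l₂ μ ω s 1‖)
    (fun k => by
      generalize alternating i k = j
      fin_cases j
      · exact le_max_left _ _
      · exact le_max_right _ _)
    (fun k => eigenvec_eq hβ h (alternating i k))
  rw [mul_comm (Complex.exp _)]
  refine tendsto_nhds_unique h2 (h1.congr fun n => Finset.sum_congr rfl fun k _ => ?_)
  generalize alternating i k = j
  fin_cases j <;> simp [eigenvec]

lemma starvationLST_eq_zero_of_rate_nonneg (hα : 0 < α) (hβ : 0 < β)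
    (hI : IsCTMC P (gen α β) i I) (hx : 0 < x) (hω : 0 < ω.re) {j : Fin 2}
    (hj : 0 ≤ rate l₁ l₂ μ j) : starvationLST P (rate l₁ l₂ μ) I j x ω = 0 := by
  obtain ⟨T, hT, hind, hlaw, hpos, hpath⟩ := hI.exists_holding hα hβ
  exact starvationLST_eq_zero hT hind (fun k => exitRate_pos hα hβ _) hlaw hpos
    (fun k => exitRate_le hα hβ _) hx hpath hω hj

/-- The second component of the eigenvector does not vanish. -/
lemma eigenvec_ne_zero (hα : 0 < α) (hβ : 0 < β) (h : charDet α β l₁ l₂ μ s ω = 0) :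
    (β : ℂ) + ω - (l₂ - μ) * s ≠ 0 := by
  intro h0
  rw [charDet_eq_zero_iff, h0, zero_mul] at h
  exact (mul_pos hβ hα).ne (by exact_mod_cast h)

end TwoState

end MMFM

end

theorem theorem1 {Ω : Type*} [MeasurableSpace Ω]
    (α β l₁ l₂ μ : ℝ) (hα : 0 < α) (hβ : 0 < β)
    -- `P i` is the law given that the environment starts in state `i`
    (P : Fin 2 → Measure Ω) [∀ i, IsProbabilityMeasure (P i)]
    (I : ℝ → Ω → Fin 2) (hI : ∀ i, MMFM.IsCTMC (P i) (MMFM.gen α β) i I)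
    (x : ℝ) (hx : 0 < x) (ω : ℂ) (hω : 0 < ω.re) :
    -- `H j` is the vector of the transforms of starvation in state `j`; its components are the
    -- initial states, in the order `state2`, `state1` of the rows of `Q` and `R`
    let H : Fin 2 → Fin 2 → ℂ := fun j i =>
      MMFM.starvationLST (P i) (MMFM.rate l₁ l₂ μ) I j x ω
    let s₁ : ℂ := MMFM.root1 α β l₁ l₂ μ ω
    let s₂ : ℂ := MMFM.root2 α β l₁ l₂ μ ω
    -- only `l₁ < μ`
    (l₁ < μ → μ ≤ l₂ →
      (∀ s : ℂ, MMFM.charDet α β l₁ l₂ μ s ω = 0 ∧ s.re < 0 ↔ s = s₁) ∧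
      H MMFM.state2 = 0 ∧
      H MMFM.state1 = Complex.exp (s₁ * x) • ![β / (β + ω - (l₂ - μ) * s₁), 1]) ∧
    -- only `l₂ < μ`
    (l₂ < μ → μ ≤ l₁ →
      (∀ s : ℂ, MMFM.charDet α β l₁ l₂ μ s ω = 0 ∧ s.re < 0 ↔ s = s₁) ∧
      H MMFM.state1 = 0 ∧
      H MMFM.state2 = Complex.exp (s₁ * x) • ![1, (β + ω - (l₂ - μ) * s₁) / β]) ∧
    -- both below `μ`
    (l₁ < μ → l₂ < μ →
      (∀ s : ℂ, MMFM.charDet α β l₁ l₂ μ s ω = 0 ↔ s = s₁ ∨ s = s₂) ∧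
      s₁.re < 0 ∧ s₂.re < 0 ∧
      (ω.im = 0 → s₁ ≠ s₂) ∧
      (s₁ ≠ s₂ →
        let a₁₁ : ℂ := β / ((l₂ - μ) * (s₂ - s₁))
        let a₂₁ : ℂ := β / ((l₂ - μ) * (s₁ - s₂))
        let a₁₂ : ℂ := (β + ω - (l₂ - μ) * s₂) / ((l₂ - μ) * (s₁ - s₂))
        let a₂₂ : ℂ := (β + ω - (l₂ - μ) * s₁) / ((l₂ - μ) * (s₂ - s₁))
        H MMFM.state1 =
          (a₂₁ * Complex.exp (s₂ * x)) • ![1, (β + ω - (l₂ - μ) * s₂) / β] +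
          (a₁₁ * Complex.exp (s₁ * x)) • ![1, (β + ω - (l₂ - μ) * s₁) / β] ∧
        H MMFM.state2 =
          (a₂₂ * Complex.exp (s₂ * x)) • ![1, (β + ω - (l₂ - μ) * s₂) / β] +
          (a₁₂ * Complex.exp (s₁ * x)) • ![1, (β + ω - (l₂ - μ) * s₁) / β])) := by
  intro H s₁ s₂
  have hβ' : (β : ℂ) ≠ 0 := by exact_mod_cast hβ.ne'
  have relation : ∀ {s : ℂ}, MMFM.charDet α β l₁ l₂ μ s ω = 0 → s.re < 0 → ∀ i,
      H MMFM.state2 i + (β + ω - (l₂ - μ) * s) / β * H MMFM.state1 i =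
        Complex.exp (s * x) * MMFM.eigenvec β l₂ μ ω s i := fun h hs i =>
    MMFM.starvationLST_relation hα hβ (hI i) hx hω hs.le h
  have vanish : ∀ j, 0 ≤ MMFM.rate l₁ l₂ μ j → H j = 0 := fun j hj => funext fun i =>
    MMFM.starvationLST_eq_zero_of_rate_nonneg hα hβ (hI i) hx hω hj
  refine ⟨fun h₁ h₂ => ?_, fun h₂ h₁ => ?_, fun h₁ h₂ => ?_⟩
  · have hroot : ∀ s : ℂ, MMFM.charDet α β l₁ l₂ μ s ω = 0 ∧ s.re < 0 ↔ s = s₁ := fun s =>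
      MMFM.charDet_eq_zero_and_re_neg_iff hα hβ hω h₁ h₂
    obtain ⟨hs, hre⟩ := (hroot s₁).2 rfl
    have hH := vanish MMFM.state2 (sub_nonneg.2 h₂)
    have hne := MMFM.eigenvec_ne_zero hα hβ hs
    refine ⟨hroot, hH, funext fun i => ?_⟩
    have := relation hs hre i
    rw [hH, Pi.zero_apply, zero_add] at this
    fin_cases i
    · simp [MMFM.eigenvec] at this ⊢
      field_simp at this ⊢
      linear_combination this
    · simp [MMFM.eigenvec] at this ⊢
      field_simp at this ⊢
      linear_combination this
  · have hroot : ∀ s : ℂ, MMFM.charDet α β l₁ l₂ μ s ω = 0 ∧ s.re < 0 ↔ s = s₁ := fun s => by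
      rw [MMFM.charDet_swap, show s₁ = _ from MMFM.root1_swap]
      exact MMFM.charDet_eq_zero_and_re_neg_iff hβ hα hω h₂ h₁
    obtain ⟨hs, hre⟩ := (hroot s₁).2 rfl
    have hH := vanish MMFM.state1 (sub_nonneg.2 h₁)
    refine ⟨hroot, hH, funext fun i => ?_⟩
    have := relation hs hre i
    rw [hH, Pi.zero_apply, mul_zero, add_zero] at this
    rw [this]
    rfl
  · have hprod : 0 < (l₁ - μ) * (l₂ - μ) := mul_pos_of_neg_of_neg (sub_neg.2 h₁) (sub_neg.2 h₂)
    have hroot : ∀ s : ℂ, MMFM.charDet α β l₁ l₂ μ s ω = 0 ↔ s = s₁ ∨ s = s₂ := fun s =>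
      MMFM.charDet_eq_zero_iff_root hprod.ne'
    have hs₁ := (hroot s₁).2 (Or.inl rfl)
    have hs₂ := (hroot s₂).2 (Or.inr rfl)
    have hre₁ := MMFM.re_neg_of_charDet_eq_zero hα hβ hω h₁ h₂ hs₁
    have hre₂ := MMFM.re_neg_of_charDet_eq_zero hα hβ hω h₁ h₂ hs₂
    refine ⟨hroot, hre₁, hre₂, MMFM.root1_ne_root2 hα hβ hprod, fun hne => ?_⟩
    have hr : (l₂ : ℂ) - μ ≠ 0 := by exact_mod_cast (sub_neg.2 h₂).ne
    have hd : s₂ - s₁ ≠ 0 := sub_ne_zero.2 hne.symm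
    have hd' : s₁ - s₂ = -(s₂ - s₁) := by ring
    have sub_rel : ∀ i, (l₂ - μ) * (s₂ - s₁) * H MMFM.state1 i =
        β * (Complex.exp (s₁ * x) * MMFM.eigenvec β l₂ μ ω s₁ i -
          Complex.exp (s₂ * x) * MMFM.eigenvec β l₂ μ ω s₂ i) := by
      intro i
      rw [← relation hs₁ hre₁ i, ← relation hs₂ hre₂ i]
      field_simp
      ring
    have eq₁ : ∀ i, H MMFM.state1 i =
        β / ((l₂ - μ) * (s₁ - s₂)) * Complex.exp (s₂ * x) * MMFM.eigenvec β l₂ μ ω s₂ i +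
        β / ((l₂ - μ) * (s₂ - s₁)) * Complex.exp (s₁ * x) * MMFM.eigenvec β l₂ μ ω s₁ i := by
      intro i
      rw [hd']
      field_simp
      linear_combination sub_rel i
    have eq₂ : ∀ i, H MMFM.state2 i =
        (β + ω - (l₂ - μ) * s₁) / ((l₂ - μ) * (s₂ - s₁)) * Complex.exp (s₂ * x) *
          MMFM.eigenvec β l₂ μ ω s₂ i +
        (β + ω - (l₂ - μ) * s₂) / ((l₂ - μ) * (s₁ - s₂)) * Complex.exp (s₁ * x) *
          MMFM.eigenvec β l₂ μ ω s₁ i := by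
      intro i
      have h := relation hs₁ hre₁ i
      rw [eq₁ i] at h
      rw [eq_sub_of_add_eq h, hd']
      field_simp
      ring
    exact ⟨funext eq₁, funext eq₂⟩
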